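/- Let $R=[a,b]\times[c,d]$ with $a<b$ and $c<d$. For points $p,q\in\mathbb R^2$ write $\Delta_x(p,q)=|p_1-q_1|$, $\Delta_y(p,q)=|p_2-q_2|$ and $d_M=\Delta_x+\Delta_y$ (Manhattan distance). Let $W\subset R$ be a finite set of $n$ (white) points. **Game.** For finite $P,Q\subset R$ the score of $P$ against $Q$ is the area of $\{x\in R:\ \exists p\in P\ \forall q\in Q,\ d_M(x,p)<d_M(x,q)\}$. The set $W$ is *unbeatable* if there is no (black) set $B\subset R$ with $|B|=n$ and $B\cap W=\varnothing$ whose score against $W$ is larger than the score of $W$ against $B$. **Cells.** The (horizontally enlarged) Voronoi cell $V(w)$ of $w\in W$ is the set of all $x\in R$ such that for every $q\in W\setminus\{w\}$ either $d_M(x,w)<d_M(x,q)$, or $\Delta_x(w,q)=\Delta_y(w,q)$, $d_M(x,w)=d_M(x,q)$ and $\Delta_y(x,q)=\Delta_y(x,w)+\Delta_y(w,q)$ (each of the two neutral regions of a degenerate bisector is assigned to the vertically nearer point). The vertical line through $w$ splits $V(w)$ into two half cells, and so does the horizontal line through $w$. The four arms of $V(w)$ are the maximal segments starting at $w$ in the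 directions right, up, left, down that are contained in $V(w)$, up to their far end points. An arm is a *boundary arm* if its end point lies on the boundary of $R$. The cell $V(w)$ is a *bridge* if it has two opposite boundary arms. **Theorem.** If $W$ is unbeatable, then the following hold. (P1) For every $w\in W$, each of the four half cells of $V(w)$ has area $\frac{1}{2n}\,\mathrm{area}(R)$. (P2) For every $w\in W$: if $V(w)$ is not a bridge, then its four arms have equal length. If $V(w)$ is a bridge, then any two opposite boundary arms of $V(w)$ have equal length and, if $|W|>1$, neither is longer than any other arm of $V(w)$. -/

import Mathlib

open MeasureTheory

noncomputable section

namespace ManhattanVoronoi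

/-- A nondegenerate axis-parallel rectangle in the plane. -/
structure Rect where
  left : ℝ
  right : ℝ
  bottom : ℝ
  top : ℝ
  left_lt_right : left < right
  bottom_lt_top : bottom < top

/-- The closed rectangle as a set of points of the plane. -/
def Rect.toSet (R : Rect) : Set (ℝ × ℝ) :=
  Set.Icc R.left R.right ×ˢ Set.Icc R.bottom R.top

/-- Two-dimensional Lebesgue measure, as a real number. It is only applied to subsets of
rectangles, whose measure is finite. -/
def area (S : Set (ℝ × ℝ)) : ℝ := (volume : Measure (ℝ × ℝ)).real S

def deltaX (p q : ℝ × ℝ) : ℝ := |p.1 - q.1|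

def deltaY (p q : ℝ × ℝ) : ℝ := |p.2 - q.2|

/-- The Manhattan distance. -/
def dM (p q : ℝ × ℝ) : ℝ := deltaX p q + deltaY p q

/-! ### The game -/

/-- The score of the player owning `P` against the opponent owning `Q`: the area of the points of
the rectangle that are closer to one of the facilities in `P` than to any facility in `Q`. -/
def score (R : Rect) (P Q : Finset (ℝ × ℝ)) : ℝ :=
  area {x | x ∈ R.toSet ∧ ∃ p ∈ P, ∀ q ∈ Q, dM x p < dM x q}

/-- `B` is a winning set for Black against the white set `W`. -/
def IsBlackWinningSet (R : Rect) (W B : Finset (ℝ × ℝ)) : Prop :=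
  (B : Set (ℝ × ℝ)) ⊆ R.toSet ∧ B.card = W.card ∧ Disjoint W B ∧ score R W B < score R B W

/-- A white set is unbeatable if it admits no winning set for Black. -/
def Unbeatable (R : Rect) (W : Finset (ℝ × ℝ)) : Prop :=
  ¬ ∃ B : Finset (ℝ × ℝ), IsBlackWinningSet R W B

/-! ### Cells of a point set owned by one player -/

/-- `x` lies on the side of `p` of the bisector of two distinct points `p` and `q` of the same
player. Apart from degenerate bisectors this says that `x` is closer to `p` than to `q`. If
`deltaX p q = deltaY p q`, the points at equal distance from `p` and `q` comprise, besides a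
segment of slope `±1`, two regions (quadrants with apexes at the other two corners of the square
spanned by `p` and `q`). The degenerate bisector is replaced by a horizontal one, that is, each
region goes to whichever of `p`, `q` is vertically nearer to it. -/
def OnSideOf (p q x : ℝ × ℝ) : Prop :=
  dM x p < dM x q ∨
    (deltaX p q = deltaY p q ∧ dM x p = dM x q ∧ deltaY x q = deltaY x p + deltaY p q)

/-- The (horizontally enlarged) Manhattan Voronoi cell of `p` with respect to `P`. -/
def cell (R : Rect) (P : Finset (ℝ × ℝ)) (p : ℝ × ℝ) : Set (ℝ × ℝ) :=
  {x | x ∈ R.toSet ∧ ∀ q ∈ P, q ≠ p → OnSideOf p q x}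

/-- The four axis directions. -/
inductive Dir
  | right
  | up
  | left
  | down

/-- The unit vector of a direction. -/
def Dir.vec : Dir → ℝ × ℝ
  | .right => (1, 0)
  | .up => (0, 1)
  | .left => (-1, 0)
  | .down => (0, -1)

/-- The opposite direction. -/
def Dir.opp : Dir → Dir
  | .right => .left
  | .up => .down
  | .left => .right
  | .down => .up

/-- The half cell of `p` in direction `e`: the right and left half cells are the two pieces into
which the vertical line through `p` splits the cell, the top and bottom half cells those into which
the horizontal line splits it. -/
def halfCell (R : Rect) (P : Finset (ℝ × ℝ)) (p : ℝ × ℝ) (e : Dir) : Set (ℝ × ℝ) :=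
  {x | x ∈ cell R P p ∧ 0 ≤ (x.1 - p.1) * e.vec.1 + (x.2 - p.2) * e.vec.2}

/-- The length of the arm of `p` in direction `e`: how far the ray rooted at `p` in direction `e`
stays in the cell of `p`. -/
def armLength (R : Rect) (P : Finset (ℝ × ℝ)) (p : ℝ × ℝ) (e : Dir) : ℝ :=
  sSup {t : ℝ | 0 ≤ t ∧ ∀ s ∈ Set.Icc 0 t, p + s • e.vec ∈ cell R P p}

/-- The arm of `p` in direction `e` is a boundary arm: its end point lies on the boundary of the
rectangle. -/
def IsBoundaryArm (R : Rect) (P : Finset (ℝ × ℝ)) (p : ℝ × ℝ) (e : Dir) : Prop :=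
  p + armLength R P p e • e.vec ∈ frontier R.toSet

/-- The cell of `p` is a bridge: it has two opposite boundary arms. -/
def IsBridge (R : Rect) (P : Finset (ℝ × ℝ)) (p : ℝ × ℝ) : Prop :=
  ∃ e : Dir, IsBoundaryArm R P p e ∧ IsBoundaryArm R P p e.opp

end ManhattanVoronoi

end

noncomputable section

namespace ManhattanVoronoi

open Set Filter Topology

/-! ### Areas of subsets of a rectangle -/

/-! Black threatens White by playing right next to white points. A black point at a tiny distance
`s` from `w` in direction `e` beats `w`, by exactly `s`, on everything at least `s` ahead, so in the
limit it takes a whole half cell (`Unbeatable.two_mul_sum_le`). Taking one half per cell, and then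
all the opposite halves, forces both totals to be exactly half of the rectangle. Exchanging a single
half shows that the four halves of a cell agree; leaving one cell alone and taking both halves of
another shows that different cells agree (`Unbeatable.area_half_of_partition`). This holds for every
way of breaking ties. Giving `w` all ties or none of them shows that the halves of its closed and of
its open cell have the same area `A = area R / (2n)`, and P1 follows by sandwiching.

For P2, a single black point captures at most `A`: otherwise Black would combine it with `n - 1`
half cells facing away from it (`Unbeatable.area_captured_singleton_le`). This is applied to a black
point close to `w`, nearly on a diagonal at coordinates about `(t, t)`. If the upper arm stops
before the boundary, this point pushes the part of the cell above the right arm upwards by about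
`t`, which gains about `t` times the length of the right arm. Compared with the right half cell it
loses about `t` times the lower arm, compared with the top half cell about `t` times the left arm.
All other errors are `O(t ^ 2)`. Hence, if the upper arm is short of the boundary, the right arm is
at most the lower arm (`right_le_down`) and at most the left arm (`right_le_left`). All symmetric
versions follow by changing the frame.

If two perpendicular arms stop early, these inequalities close up to equality of all four arms. For
bridges they give nearly everything; when three arms reach the boundary, a comparison of areas of
rectangles (`Unbeatable.room_opp_le_arm`) supplies the rest. The estimates are made for open cells;
`Unbeatable.armLength_eq` shows that degenerate bisectors do not lengthen the arms. -/

theorem Rect.measurableSet_toSet (R : Rect) : MeasurableSet R.toSet :=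
  measurableSet_Icc.prod measurableSet_Icc

theorem Rect.volume_toSet_ne_top (R : Rect) : volume R.toSet ≠ ⊤ :=
  (isCompact_Icc.prod isCompact_Icc).measure_lt_top.ne

theorem Rect.mem_toSet {R : Rect} {x : ℝ × ℝ} :
    x ∈ R.toSet ↔ (R.left ≤ x.1 ∧ x.1 ≤ R.right) ∧ (R.bottom ≤ x.2 ∧ x.2 ≤ R.top) := by
  simp only [Rect.toSet, Set.mem_prod, mem_Icc]

theorem Rect.volume_ne_top {R : Rect} {S : Set (ℝ × ℝ)} (h : S ⊆ R.toSet) : volume S ≠ ⊤ :=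
  ne_top_of_le_ne_top R.volume_toSet_ne_top (measure_mono h)

theorem area_prod_Icc {a b c d : ℝ} (hab : a ≤ b) (hcd : c ≤ d) :
    area (Icc a b ×ˢ Icc c d) = (b - a) * (d - c) := by
  rw [area, Measure.volume_eq_prod, measureReal_prod_prod, Real.volume_real_Icc_of_le hab,
    Real.volume_real_Icc_of_le hcd]

theorem Rect.area_toSet (R : Rect) :
    area R.toSet = (R.right - R.left) * (R.top - R.bottom) :=
  area_prod_Icc R.left_lt_right.le R.bottom_lt_top.le

theorem Rect.area_pos (R : Rect) : 0 < area R.toSet := by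
  rw [R.area_toSet]
  exact mul_pos (sub_pos.2 R.left_lt_right) (sub_pos.2 R.bottom_lt_top)

theorem Rect.area_mono (R : Rect) {S T : Set (ℝ × ℝ)} (hT : T ⊆ R.toSet) (h : S ⊆ T) :
    area S ≤ area T :=
  measureReal_mono h (Rect.volume_ne_top hT)

theorem Rect.area_union (R : Rect) {S T : Set (ℝ × ℝ)} (hS : S ⊆ R.toSet) (hT : T ⊆ R.toSet)
    (hd : Disjoint S T) (hm : MeasurableSet T) : area (S ∪ T) = area S + area T :=
  measureReal_union hd hm (Rect.volume_ne_top hS) (Rect.volume_ne_top hT)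

theorem area_union_le (S T : Set (ℝ × ℝ)) : area (S ∪ T) ≤ area S + area T :=
  measureReal_union_le S T

theorem Rect.area_biUnion (R : Rect) {ι : Type*} (s : Finset ι) (T : ι → Set (ℝ × ℝ))
    (hT : ∀ i ∈ s, T i ⊆ R.toSet) (hd : (s : Set ι).PairwiseDisjoint T)
    (hm : ∀ i ∈ s, MeasurableSet (T i)) : area (⋃ i ∈ s, T i) = ∑ i ∈ s, area (T i) := by
  unfold area
  exact measureReal_biUnion_finset hd hm (fun i hi ↦ Rect.volume_ne_top (hT i hi))

/-! ### Distances and offsets -/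

theorem continuous_dM (p : ℝ × ℝ) : Continuous fun x ↦ dM x p := by
  unfold dM deltaX deltaY
  fun_prop

/-- The signed distance by which `x` is ahead of `p` in direction `e`. -/
def offset (p : ℝ × ℝ) (e : Dir) (x : ℝ × ℝ) : ℝ :=
  (x.1 - p.1) * e.vec.1 + (x.2 - p.2) * e.vec.2

theorem continuous_offset (p : ℝ × ℝ) (e : Dir) : Continuous (offset p e) := by
  unfold offset
  fun_prop

@[simp]
theorem Dir.opp_opp (e : Dir) : e.opp.opp = e := by cases e <;> rfl

theorem offset_opp (p : ℝ × ℝ) (e : Dir) (x : ℝ × ℝ) : offset p e.opp x = -offset p e x := by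
  cases e <;> simp [offset, Dir.opp, Dir.vec]

theorem dM_pos {x y : ℝ × ℝ} (h : x ≠ y) : 0 < dM x y := by
  have h0 : 0 ≤ dM x y := by unfold dM deltaX deltaY; positivity
  refine h0.lt_of_ne fun h1 ↦ h ?_
  unfold dM deltaX deltaY at h1
  have a1 := abs_nonneg (x.1 - y.1)
  have a2 := abs_nonneg (x.2 - y.2)
  refine Prod.ext (sub_eq_zero.1 (abs_eq_zero.1 ?_)) (sub_eq_zero.1 (abs_eq_zero.1 ?_)) <;> linarith

@[simp]
theorem dM_self (x : ℝ × ℝ) : dM x x = 0 := by simp [dM, deltaX, deltaY]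

/-- The open half plane of `p` in direction `e`. -/
def openHalf (p : ℝ × ℝ) (e : Dir) : Set (ℝ × ℝ) := {x | 0 < offset p e x}

theorem measurableSet_openHalf (p : ℝ × ℝ) (e : Dir) : MeasurableSet (openHalf p e) :=
  (isOpen_lt continuous_const (continuous_offset p e)).measurableSet

theorem volume_offset_eq_zero (p : ℝ × ℝ) (e : Dir) :
    volume {x : ℝ × ℝ | offset p e x = 0} = 0 := by
  have h1 : volume (({p.1} : Set ℝ) ×ˢ (univ : Set ℝ)) = 0 := by
    simp [Measure.volume_eq_prod]
  have h2 : volume ((univ : Set ℝ) ×ˢ ({p.2} : Set ℝ)) = 0 := by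
    simp [Measure.volume_eq_prod]
  cases e
  · refine measure_mono_null (fun x hx ↦ ?_) h1
    simp [offset, Dir.vec] at hx
    simp; linarith
  · refine measure_mono_null (fun x hx ↦ ?_) h2
    simp [offset, Dir.vec] at hx
    simp; linarith
  · refine measure_mono_null (fun x hx ↦ ?_) h1
    simp [offset, Dir.vec] at hx
    simp; linarith
  · refine measure_mono_null (fun x hx ↦ ?_) h2
    simp [offset, Dir.vec] at hx
    simp; linarith

/-- The dividing line is null, so the overlapping closed halves of the statement may be replaced by
disjoint open ones. -/
theorem area_inter_offset_nonneg (S : Set (ℝ × ℝ)) (p : ℝ × ℝ) (e : Dir) :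
    area (S ∩ {x | 0 ≤ offset p e x}) = area (S ∩ openHalf p e) := by
  refine measureReal_congr ?_
  have h : ∀ᵐ x : ℝ × ℝ, offset p e x ≠ 0 := by
    rw [ae_iff]; simpa using volume_offset_eq_zero p e
  filter_upwards [h] with x hx
  apply propext
  change x ∈ S ∧ 0 ≤ offset p e x ↔ x ∈ S ∧ 0 < offset p e x
  rw [lt_iff_le_and_ne]
  exact ⟨fun h ↦ ⟨h.1, h.2, hx.symm⟩, fun h ↦ ⟨h.1, h.2.1⟩⟩

theorem Rect.area_halves (R : Rect) {S : Set (ℝ × ℝ)} (hS : S ⊆ R.toSet)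
    (p : ℝ × ℝ) (e : Dir) :
    area (S ∩ openHalf p e) + area (S ∩ openHalf p e.opp) = area S := by
  rw [← area_inter_offset_nonneg S p e.opp]
  have h : {x | 0 ≤ offset p e.opp x} = (openHalf p e)ᶜ := by
    ext x; simp [openHalf, offset_opp]
  rw [h, ← Set.sdiff_eq]
  exact measureReal_inter_add_sdiff (measurableSet_openHalf p e) (Rect.volume_ne_top hS)

/-! ### Captured regions -/

/-- The points of the rectangle that are closer to a point of `B` than to any point of `W`. -/
def captured (R : Rect) (W B : Finset (ℝ × ℝ)) : Set (ℝ × ℝ) :=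
  {x | x ∈ R.toSet ∧ ∃ p ∈ B, ∀ q ∈ W, dM x p < dM x q}

theorem captured_subset (R : Rect) (W B : Finset (ℝ × ℝ)) : captured R W B ⊆ R.toSet :=
  fun _ hx ↦ hx.1

theorem captured_mono (R : Rect) (W : Finset (ℝ × ℝ)) {B B' : Finset (ℝ × ℝ)} (h : B ⊆ B') :
    captured R W B ⊆ captured R W B' :=
  fun _ hx ↦ ⟨hx.1, hx.2.imp fun _ hp ↦ ⟨h hp.1, hp.2⟩⟩

theorem measurableSet_captured (R : Rect) (W B : Finset (ℝ × ℝ)) :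
    MeasurableSet (captured R W B) := by
  have : captured R W B = R.toSet ∩ ⋃ p ∈ B, ⋂ q ∈ W, {x | dM x p < dM x q} := by
    ext x; simp [captured]
  rw [this]
  exact R.measurableSet_toSet.inter (Finset.measurableSet_biUnion _ fun p _ ↦
    Finset.measurableSet_biInter _ fun q _ ↦
      (isOpen_lt (continuous_dM p) (continuous_dM q)).measurableSet)

theorem Rect.toSet_infinite (R : Rect) : R.toSet.Infinite := fun h ↦ by
  have : area R.toSet = 0 := by simp [area, Measure.real, h.measure_zero volume]
  exact R.area_pos.ne' this

/-- Black may use fewer points than White: the missing ones can be added anywhere. -/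
theorem Unbeatable.two_mul_area_captured_le {R : Rect} {W : Finset (ℝ × ℝ)}
    (hunb : Unbeatable R W) {B : Finset (ℝ × ℝ)} (hB : (B : Set (ℝ × ℝ)) ⊆ R.toSet)
    (hdis : Disjoint W B) (hcard : B.card ≤ W.card) :
    2 * area (captured R W B) ≤ area R.toSet := by
  classical
  have hinf : (R.toSet \ (W ∪ B : Finset (ℝ × ℝ))).Infinite :=
    R.toSet_infinite.sdiff (Finset.finite_toSet _)
  obtain ⟨D, hD, hDc⟩ := hinf.exists_subset_card_eq (W.card - B.card)
  have hDB : Disjoint B D := Finset.disjoint_left.2 fun x hx hx' ↦ (hD hx').2 (by simp [hx])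
  have hDW : Disjoint W D := Finset.disjoint_left.2 fun x hx hx' ↦ (hD hx').2 (by simp [hx])
  have hle : score R (B ∪ D) W ≤ score R W (B ∪ D) := by
    by_contra! hlt
    refine hunb ⟨B ∪ D, ?_, ?_, ?_, hlt⟩
    · rw [Finset.coe_union]
      exact union_subset hB fun x hx ↦ (hD hx).1
    · rw [Finset.card_union_of_disjoint hDB, hDc]; omega
    · exact Finset.disjoint_union_right.2 ⟨hdis, hDW⟩
  have h1 : area (captured R W B) ≤ score R (B ∪ D) W :=
    R.area_mono (captured_subset R W (B ∪ D)) (captured_mono R W Finset.subset_union_left)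
  have h2 : score R (B ∪ D) W + score R W (B ∪ D) ≤ area R.toSet := by
    have h3 : Disjoint (captured R W (B ∪ D)) (captured R (B ∪ D) W) := by
      rw [Set.disjoint_left]
      rintro x ⟨-, p, hp, hp'⟩ ⟨-, q, hq, hq'⟩
      exact lt_asymm (hp' q hq) (hq' p hp)
    have h4 := R.area_union (captured_subset R W (B ∪ D)) (captured_subset R (B ∪ D) W) h3
      (measurableSet_captured _ _ _)
    have h5 : captured R W (B ∪ D) ∪ captured R (B ∪ D) W ⊆ R.toSet :=
      union_subset (captured_subset _ _ _) (captured_subset _ _ _)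
    have h6 := R.area_mono subset_rfl h5
    change area (captured R W (B ∪ D)) + area (captured R (B ∪ D) W) ≤ _
    linarith
  linarith

/-! ### Closed and open cells -/

/-- The points of the rectangle to which no point of `W` is closer than `w`. -/
def closedCell (R : Rect) (W : Finset (ℝ × ℝ)) (w : ℝ × ℝ) : Set (ℝ × ℝ) :=
  {x | x ∈ R.toSet ∧ ∀ q ∈ W, dM x w ≤ dM x q}

/-- The points of the rectangle that are closer to `w` than to any other point of `W`. -/
def openCell (R : Rect) (W : Finset (ℝ × ℝ)) (w : ℝ × ℝ) : Set (ℝ × ℝ) :=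
  {x | x ∈ R.toSet ∧ ∀ q ∈ W, q ≠ w → dM x w < dM x q}

theorem closedCell_subset (R : Rect) (W : Finset (ℝ × ℝ)) (w : ℝ × ℝ) :
    closedCell R W w ⊆ R.toSet := fun _ hx ↦ hx.1

theorem openCell_subset_closedCell (R : Rect) (W : Finset (ℝ × ℝ)) (w : ℝ × ℝ) :
    openCell R W w ⊆ closedCell R W w := fun x hx ↦ ⟨hx.1, fun q hq ↦ by
  rcases eq_or_ne q w with rfl | h
  exacts [le_rfl, (hx.2 q hq h).le]⟩

theorem openCell_subset_cell (R : Rect) (W : Finset (ℝ × ℝ)) (w : ℝ × ℝ) :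
    openCell R W w ⊆ cell R W w := fun _ hx ↦ ⟨hx.1, fun q hq h ↦ Or.inl (hx.2 q hq h)⟩

theorem cell_subset_closedCell (R : Rect) (W : Finset (ℝ × ℝ)) (w : ℝ × ℝ) :
    cell R W w ⊆ closedCell R W w := fun x hx ↦ ⟨hx.1, fun q hq ↦ by
  rcases eq_or_ne q w with rfl | h
  · exact le_rfl
  · rcases hx.2 q hq h with h | h
    exacts [h.le, h.2.1.le]⟩

theorem measurableSet_openCell (R : Rect) (W : Finset (ℝ × ℝ)) (w : ℝ × ℝ) :
    MeasurableSet (openCell R W w) := by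
  have : openCell R W w = R.toSet ∩ ⋂ q ∈ W.filter (· ≠ w), {x | dM x w < dM x q} := by
    ext x; simp [openCell]
  rw [this]
  exact R.measurableSet_toSet.inter (Finset.measurableSet_biInter _ fun q _ ↦
      (isOpen_lt (continuous_dM w) (continuous_dM q)).measurableSet)

theorem measurableSet_closedCell (R : Rect) (W : Finset (ℝ × ℝ)) (w : ℝ × ℝ) :
    MeasurableSet (closedCell R W w) := by
  have : closedCell R W w = R.toSet ∩ ⋂ q ∈ W, {x | dM x w ≤ dM x q} := by
    ext x; simp [closedCell]
  rw [this]
  exact R.measurableSet_toSet.inter (Finset.measurableSet_biInter _ fun q _ ↦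
      (isClosed_le (continuous_dM w) (continuous_dM q)).measurableSet)

/-- The step is the beginning of a shortest Manhattan path from `w` to `x`. This is what makes a
black point beside `w` win everything ahead of it. -/
theorem dM_add_smul_vec {w x : ℝ × ℝ} {e : Dir} {s : ℝ} (hs : 0 ≤ s) (h : s ≤ offset w e x) :
    dM x (w + s • e.vec) = dM x w - s := by
  cases e <;> simp [offset, Dir.vec, dM, deltaX, deltaY] at h ⊢
  · rw [abs_of_nonneg (by linarith), abs_of_nonneg (by linarith : (0:ℝ) ≤ x.1 - w.1)]; ring
  · rw [abs_of_nonneg (by linarith : 0 ≤ x.2 - (w.2 + s)),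
      abs_of_nonneg (by linarith : (0:ℝ) ≤ x.2 - w.2)]; ring
  · rw [abs_of_nonpos (by linarith), abs_of_nonpos (by linarith : x.1 - w.1 ≤ 0)]; ring
  · rw [abs_of_nonpos (by linarith : x.2 - (w.2 + -s) ≤ 0),
      abs_of_nonpos (by linarith : x.2 - w.2 ≤ 0)]; ring

theorem Rect.add_smul_vec_mem {R : Rect} {w x : ℝ × ℝ} {e : Dir} {s : ℝ} (hw : w ∈ R.toSet)
    (hx : x ∈ R.toSet) (hs : 0 ≤ s) (h : s ≤ offset w e x) : w + s • e.vec ∈ R.toSet := by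
  rw [Rect.mem_toSet] at *
  cases e <;> simp [offset, Dir.vec] at h ⊢ <;> refine ⟨⟨?_, ?_⟩, ?_, ?_⟩ <;> linarith

theorem add_smul_vec_ne {w : ℝ × ℝ} {e : Dir} {s : ℝ} (hs : 0 < s) : w + s • e.vec ≠ w := by
  cases e <;> simp [Dir.vec, Prod.ext_iff, hs.ne']

theorem tendsto_area_inter_offset_ge {R : Rect} {T : Set (ℝ × ℝ)} (hT : T ⊆ R.toSet)
    {w : ℝ × ℝ} {e : Dir} (hTe : T ⊆ openHalf w e) :
    Tendsto (fun k : ℕ ↦ area (T ∩ {x | 1 / ((k : ℝ) + 1) ≤ offset w e x})) atTop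
      (𝓝 (area T)) := by
  have hU : T = ⋃ k : ℕ, T ∩ {x | 1 / ((k : ℝ) + 1) ≤ offset w e x} := by
    rw [← inter_iUnion]
    refine (inter_eq_left.2 fun x hx ↦ ?_).symm
    have h0 : 0 < offset w e x := hTe hx
    obtain ⟨k, hk⟩ := exists_nat_one_div_lt h0
    exact mem_iUnion.2 ⟨k, hk.le⟩
  have hm : Monotone fun k : ℕ ↦ T ∩ {x | 1 / ((k : ℝ) + 1) ≤ offset w e x} := by
    intro i j hij
    refine inter_subset_inter_right _ fun x hx ↦ ?_
    have : 1 / ((j : ℝ) + 1) ≤ 1 / ((i : ℝ) + 1) := by gcongr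
    exact this.trans hx
  have := tendsto_measure_iUnion_atTop (μ := (volume : Measure (ℝ × ℝ))) hm
  rw [← hU] at this
  exact (ENNReal.tendsto_toReal (Rect.volume_ne_top hT)).comp this

/-- Black can take, up to an arbitrarily small area, any disjoint family of half cells by placing
points next to the white ones. -/
theorem Unbeatable.two_mul_sum_le {R : Rect} {W : Finset (ℝ × ℝ)}
    (hW : (W : Set (ℝ × ℝ)) ⊆ R.toSet) (hunb : Unbeatable R W) {B : Finset (ℝ × ℝ)}
    (hB : (B : Set (ℝ × ℝ)) ⊆ R.toSet) (hdis : Disjoint W B) {ι : Type*} (S : Finset ι)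
    (p : ι → ℝ × ℝ) (e : ι → Dir) (T : ι → Set (ℝ × ℝ)) (hp : ∀ i ∈ S, p i ∈ W)
    (hT : ∀ i ∈ S, T i ⊆ closedCell R W (p i) ∩ openHalf (p i) (e i))
    (hTm : ∀ i ∈ S, MeasurableSet (T i)) (hTd : (S : Set ι).PairwiseDisjoint T)
    (hTB : ∀ i ∈ S, Disjoint (captured R W B) (T i)) (hcard : B.card + S.card ≤ W.card) :
    2 * (area (captured R W B) + ∑ i ∈ S, area (T i)) ≤ area R.toSet := by
  classical
  set T' : ℕ → ι → Set (ℝ × ℝ) :=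
    fun k i ↦ T i ∩ {x | 1 / ((k : ℝ) + 1) ≤ offset (p i) (e i) x} with hT'
  have hTR : ∀ i ∈ S, T i ⊆ R.toSet := fun i hi x hx ↦ (hT i hi hx).1.1
  have hlim : Tendsto (fun k : ℕ ↦ 2 * (area (captured R W B) + ∑ i ∈ S, area (T' k i))) atTop
      (𝓝 (2 * (area (captured R W B) + ∑ i ∈ S, area (T i)))) := by
    refine Tendsto.const_mul _ (Tendsto.const_add _ (tendsto_finsetSum _ fun i hi ↦ ?_))
    exact tendsto_area_inter_offset_ge (hTR i hi) fun x hx ↦ (hT i hi hx).2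
  -- Black may not use white positions; the other white points stay at positive distance from `p i`.
  have hne : ∀ᶠ k : ℕ in atTop, ∀ i ∈ S, p i + (1 / ((k : ℝ) + 1)) • (e i).vec ∉ W := by
    rw [Filter.eventually_all_finset]
    intro i hi
    have h1 : Tendsto (fun k : ℕ ↦ p i + (1 / ((k : ℝ) + 1)) • (e i).vec) atTop (𝓝 (p i)) := by
      have := (tendsto_one_div_add_atTop_nhds_zero_nat (𝕜 := ℝ)).smul_const (e i).vec
      simpa using this.const_add (p i)
    have h2 : ∀ᶠ y in 𝓝 (p i), y ∉ W.erase (p i) :=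
      (Finset.finite_toSet _).isClosed.isOpen_compl.mem_nhds (by simp)
    filter_upwards [h1.eventually h2] with k hk hk'
    exact hk (Finset.mem_erase.2 ⟨add_smul_vec_ne (by positivity), hk'⟩)
  refine le_of_tendsto hlim ?_
  filter_upwards [hne] with k hk
  set s : ℝ := 1 / ((k : ℝ) + 1) with hs
  have hs0 : 0 < s := by positivity
  -- Candidates outside the rectangle are dropped. Nothing is lost: a point of `T i` at least `s`
  -- ahead of `p i` forces the candidate to lie in the rectangle.
  set B' : Finset (ℝ × ℝ) :=
    B ∪ (S.image fun i ↦ p i + s • (e i).vec).filter (· ∈ R.toSet) with hB'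
  have h1 : (B' : Set (ℝ × ℝ)) ⊆ R.toSet := by
    rw [hB', Finset.coe_union]
    exact union_subset hB fun x hx ↦ (Finset.mem_filter.1 hx).2
  have h2 : Disjoint W B' := by
    refine Finset.disjoint_union_right.2 ⟨hdis, Finset.disjoint_left.2 fun x hx hx' ↦ ?_⟩
    obtain ⟨i, hi, rfl⟩ := Finset.mem_image.1 (Finset.mem_filter.1 hx').1
    exact hk i hi hx
  have h3 : B'.card ≤ W.card := by
    refine (Finset.card_union_le _ _).trans (le_trans ?_ hcard)
    gcongr
    exact (Finset.card_filter_le _ _).trans Finset.card_image_le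
  have h4 := hunb.two_mul_area_captured_le h1 h2 h3
  have hTm' : ∀ i ∈ S, MeasurableSet (T' k i) := fun i hi ↦ (hTm i hi).inter
    (isClosed_le continuous_const (continuous_offset _ _)).measurableSet
  have h5 : captured R W B ∪ ⋃ i ∈ S, T' k i ⊆ captured R W B' := by
    refine union_subset (captured_mono R W Finset.subset_union_left) (iUnion₂_subset ?_)
    rintro i hi x ⟨hx, hxs⟩
    have hxs : s ≤ offset (p i) (e i) x := hxs
    obtain ⟨⟨hxR, hxc⟩, -⟩ := hT i hi hx
    refine ⟨hxR, p i + s • (e i).vec, ?_, fun q hq ↦ ?_⟩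
    · refine Finset.mem_union_right _ (Finset.mem_filter.2 ⟨Finset.mem_image_of_mem _ hi, ?_⟩)
      exact Rect.add_smul_vec_mem (hW (hp i hi)) hxR hs0.le hxs
    · rw [dM_add_smul_vec hs0.le hxs]
      have := hxc q hq
      linarith
  have h6 : area (captured R W B ∪ ⋃ i ∈ S, T' k i) =
      area (captured R W B) + ∑ i ∈ S, area (T' k i) := by
    rw [R.area_union (captured_subset _ _ _), R.area_biUnion]
    · exact fun i hi ↦ inter_subset_left.trans (hTR i hi)
    · exact hTd.mono fun i ↦ inter_subset_left
    · exact hTm'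
    · exact iUnion₂_subset fun i hi ↦ inter_subset_left.trans (hTR i hi)
    · exact disjoint_iUnion₂_right.2 fun i hi ↦ (hTB i hi).mono_right inter_subset_left
    · exact Finset.measurableSet_biUnion _ hTm'
  have h7 := R.area_mono (captured_subset R W B') h5
  rw [h6] at h7
  linarith

/-! ### Half cells of an unbeatable set -/

theorem disjoint_openHalf_opp (p : ℝ × ℝ) (e : Dir) :
    Disjoint (openHalf p e) (openHalf p e.opp) := by
  rw [Set.disjoint_left]
  intro x (h : 0 < offset p e x) (h' : 0 < offset p e.opp x)
  rw [offset_opp] at h'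
  linarith

theorem captured_empty (R : Rect) (W : Finset (ℝ × ℝ)) : captured R W ∅ = ∅ := by
  ext x; simp [captured]

/-- If the rectangle is divided into pieces of closed cells, then all halves of all the pieces have
the same area. -/
theorem Unbeatable.area_half_of_partition {R : Rect} {W : Finset (ℝ × ℝ)}
    (hW : (W : Set (ℝ × ℝ)) ⊆ R.toSet) (hunb : Unbeatable R W) (C : ℝ × ℝ → Set (ℝ × ℝ))
    (hC : ∀ w ∈ W, C w ⊆ closedCell R W w) (hCm : ∀ w ∈ W, MeasurableSet (C w))
    (hCd : (W : Set (ℝ × ℝ)).PairwiseDisjoint C) (hCR : ⋃ w ∈ W, C w = R.toSet)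
    {w : ℝ × ℝ} (hw : w ∈ W) (e : Dir) :
    area (C w ∩ openHalf w e) = 1 / (2 * (W.card : ℝ)) * area R.toSet := by
  classical
  have hCS : ∀ w ∈ W, C w ⊆ R.toSet := fun w hw x hx ↦ (hC w hw hx).1
  set h : ℝ × ℝ → Dir → ℝ := fun w e ↦ area (C w ∩ openHalf w e) with hh
  have hsum : ∑ w ∈ W, area (C w) = area R.toSet := by
    rw [← R.area_biUnion W C hCS hCd hCm, hCR]
  have hopp : ∀ w ∈ W, ∀ e, h w e + h w e.opp = area (C w) := fun w hw e ↦
    R.area_halves (hCS w hw) w e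
  have key1 : ∀ ε : ℝ × ℝ → Dir, 2 * ∑ w ∈ W, h w (ε w) ≤ area R.toSet := by
    intro ε
    have := hunb.two_mul_sum_le hW (B := ∅) (by simp) (by simp) W id ε
      (fun w ↦ C w ∩ openHalf w (ε w)) (fun w hw ↦ hw)
      (fun w hw ↦ inter_subset_inter_left _ (hC w hw))
      (fun w hw ↦ (hCm w hw).inter (measurableSet_openHalf _ _))
      (hCd.mono fun w ↦ inter_subset_left) (by simp [captured_empty]) (by simp)
    simpa [captured_empty, area, hh] using this
  -- A choice of halves and the opposite choice each total at most half of the area, and together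
  -- they give all of it.
  have key2 : ∀ ε : ℝ × ℝ → Dir, 2 * ∑ w ∈ W, h w (ε w) = area R.toSet := by
    intro ε
    have h1 := key1 ε
    have h2 := key1 fun w ↦ (ε w).opp
    have h3 : ∑ w ∈ W, h w (ε w) + ∑ w ∈ W, h w (ε w).opp = area R.toSet := by
      rw [← Finset.sum_add_distrib, ← hsum]
      exact Finset.sum_congr rfl fun w hw ↦ hopp w hw _
    linarith
  -- Only the half chosen at `w` is varied, and the total does not change.
  have key3 : ∀ w ∈ W, ∀ e e', h w e = h w e' := by
    intro w hw e e'
    have aux : ∀ e, h w e + ∑ v ∈ W.erase w, h v Dir.right = area R.toSet / 2 := by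
      intro e
      have h1 := key2 (Function.update (fun _ ↦ Dir.right) w e)
      rw [← Finset.add_sum_erase W _ hw, Function.update_self] at h1
      have h2 : ∑ v ∈ W.erase w, h v (Function.update (fun _ ↦ Dir.right) w e v) =
          ∑ v ∈ W.erase w, h v Dir.right := by
        refine Finset.sum_congr rfl fun v hv ↦ ?_
        rw [Function.update_of_ne (Finset.ne_of_mem_erase hv)]
      rw [h2] at h1
      linarith
    linarith [aux e, aux e']
  have key4 : ∀ w ∈ W, ∀ v ∈ W, h v Dir.right ≤ h w Dir.right := by
    intro w hw v hv
    rcases eq_or_ne w v with rfl | hne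
    · exact le_rfl
    -- Black ignores `w` and spends the point saved on the second half of `v`.
    set S : Finset ((ℝ × ℝ) × Dir) := insert (v, Dir.left) ((W.erase w).image (·, Dir.right))
      with hS
    have hnot : (v, Dir.left) ∉ (W.erase w).image (·, Dir.right) := by simp
    have hSW : ∀ i ∈ S, i.1 ∈ W := by
      intro i hi
      rcases Finset.mem_insert.1 hi with rfl | hi
      · exact hv
      · obtain ⟨u, hu, rfl⟩ := Finset.mem_image.1 hi
        exact Finset.mem_of_mem_erase hu
    have h1 := hunb.two_mul_sum_le hW (B := ∅) (by simp) (by simp) S Prod.fst Prod.snd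
      (fun i ↦ C i.1 ∩ openHalf i.1 i.2) hSW
      (fun i hi ↦ inter_subset_inter_left _ (hC i.1 (hSW i hi)))
      (fun i hi ↦ (hCm _ (hSW i hi)).inter (measurableSet_openHalf _ _)) ?_
      (by simp [captured_empty]) ?_
    · rw [captured_empty, hS, Finset.sum_insert hnot, Finset.sum_image (by simp)] at h1
      have h2 := key2 fun _ ↦ Dir.right
      rw [← Finset.add_sum_erase W _ hw] at h2
      have h3 : area (C v ∩ openHalf v Dir.left) = h v Dir.right := key3 v hv _ _
      have h4 : ∑ u ∈ W.erase w, area (C u ∩ openHalf u Dir.right) =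
        ∑ u ∈ W.erase w, h u Dir.right := rfl
      have h5 : area ∅ = 0 := by simp [area]
      simp only [h3, h4, h5] at h1
      linarith
    · intro i hi j hj hij
      rcases eq_or_ne i.1 j.1 with h | h
      · have : i.2 ≠ j.2 := fun h' ↦ hij (Prod.ext h h')
        have hi2 : i.2 = Dir.left ∨ i.2 = Dir.right := by
          rcases Finset.mem_insert.1 hi with rfl | hi
          · exact Or.inl rfl
          · obtain ⟨u, hu, rfl⟩ := Finset.mem_image.1 hi
            exact Or.inr rfl
        have hj2 : j.2 = Dir.left ∨ j.2 = Dir.right := by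
          rcases Finset.mem_insert.1 hj with rfl | hj
          · exact Or.inl rfl
          · obtain ⟨u, hu, rfl⟩ := Finset.mem_image.1 hj
            exact Or.inr rfl
        have h6 : j.2 = i.2.opp := by
          rcases hi2 with h1 | h1 <;> rcases hj2 with h2 | h2 <;> simp_all [Dir.opp]
        change Disjoint (C i.1 ∩ openHalf i.1 i.2) (C j.1 ∩ openHalf j.1 j.2)
        rw [h6, ← h]
        exact (disjoint_openHalf_opp i.1 i.2).mono inter_subset_right inter_subset_right
      · exact (hCd (hSW i hi) (hSW j hj) h).mono inter_subset_left inter_subset_left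
    · rw [Finset.card_empty, zero_add, hS, Finset.card_insert_of_notMem hnot,
        Finset.card_image_of_injective _ (Prod.mk_left_injective _), Finset.card_erase_add_one hw]
  have key5 : ∀ v ∈ W, h v Dir.right = h w e := by
    intro v hv
    rw [key3 w hw e Dir.right]
    exact le_antisymm (key4 w hw v hv) (key4 v hv w hw)
  have key6 := key2 fun _ ↦ Dir.right
  rw [Finset.sum_congr rfl key5, Finset.sum_const, nsmul_eq_mul] at key6
  have hn : (0 : ℝ) < W.card := by exact_mod_cast Finset.card_pos.2 ⟨w, hw⟩
  change h w e = _
  rw [← key6]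
  field_simp

/-! ### Tie-breaking rules and the proof of P1 -/

/-- The cell of `w` when ties are broken by the rank `ρ`. -/
def rankCell {β : Type*} [LinearOrder β] (R : Rect) (W : Finset (ℝ × ℝ)) (ρ : ℝ × ℝ → β)
    (w : ℝ × ℝ) : Set (ℝ × ℝ) :=
  {x | x ∈ R.toSet ∧ ∀ q ∈ W, dM x w < dM x q ∨ (dM x w = dM x q ∧ ρ w ≤ ρ q)}

/-- An injective rank leaves every point with exactly one best white point in the lexicographic
order by distance and rank, so the rank cells partition the rectangle. -/
theorem Unbeatable.area_half_rankCell {β : Type*} [LinearOrder β] {R : Rect}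
    {W : Finset (ℝ × ℝ)} (hW : (W : Set (ℝ × ℝ)) ⊆ R.toSet) (hunb : Unbeatable R W)
    {ρ : ℝ × ℝ → β} (hρ : Function.Injective ρ) {w : ℝ × ℝ} (hw : w ∈ W) (e : Dir) :
    area (rankCell R W ρ w ∩ openHalf w e) = 1 / (2 * (W.card : ℝ)) * area R.toSet := by
  refine hunb.area_half_of_partition hW (rankCell R W ρ) ?_ ?_ ?_ ?_ hw e
  · intro w _ x hx
    refine ⟨hx.1, fun q hq ↦ ?_⟩
    rcases hx.2 q hq with h | h
    exacts [h.le, h.1.le]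
  · intro w _
    have : rankCell R W ρ w = R.toSet ∩ ⋂ q ∈ W,
        ({x | dM x w < dM x q} ∪ ({x | dM x w = dM x q} ∩ {_x | ρ w ≤ ρ q})) := by
      ext x; simp [rankCell]
    rw [this]
    refine R.measurableSet_toSet.inter (Finset.measurableSet_biInter _ fun q _ ↦ ?_)
    exact (isOpen_lt (continuous_dM w) (continuous_dM q)).measurableSet.union
      ((isClosed_eq (continuous_dM w) (continuous_dM q)).measurableSet.inter (.const _))
  · intro p hp q hq hpq
    change Disjoint _ _
    rw [Set.disjoint_left]
    intro x hx hx'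
    rcases hx.2 q hq with h1 | h1 <;> rcases hx'.2 p hp with h2 | h2
    · exact lt_asymm h1 h2
    · exact h1.ne' h2.1
    · exact h2.ne' h1.1
    · exact hpq (hρ (le_antisymm h1.2 h2.2))
  · refine subset_antisymm (iUnion₂_subset fun w _ x hx ↦ hx.1) fun x hx ↦ ?_
    obtain ⟨p, hp, hmin⟩ := W.exists_min_image (fun q ↦ toLex (dM x q, ρ q)) ⟨w, hw⟩
    refine mem_iUnion₂.2 ⟨p, hp, hx, fun q hq ↦ ?_⟩
    simpa [Prod.Lex.toLex_le_toLex] using hmin q hq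

/-- With `w` ranked first it wins all ties, and its rank cell is the closed cell. The second
component of the rank only serves injectivity. -/
theorem Unbeatable.area_half_closedCell {R : Rect} {W : Finset (ℝ × ℝ)}
    (hW : (W : Set (ℝ × ℝ)) ⊆ R.toSet) (hunb : Unbeatable R W) {w : ℝ × ℝ} (hw : w ∈ W)
    (e : Dir) :
    area (closedCell R W w ∩ openHalf w e) = 1 / (2 * (W.card : ℝ)) * area R.toSet := by
  classical
  set ρ : ℝ × ℝ → ℕ ×ₗ (ℝ ×ₗ ℝ) := fun q ↦ toLex (if q = w then 0 else 1, toLex q) with hρ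
  have hinj : Function.Injective ρ := fun p q h ↦ by
    simpa using (Prod.ext_iff.1 (toLex.injective h)).2
  rw [← hunb.area_half_rankCell hW hinj hw e]
  congr 2
  ext x
  refine and_congr_right fun _ ↦ forall₂_congr fun q hq ↦ ?_
  have : ρ w ≤ ρ q := by
    rcases eq_or_ne q w with rfl | h
    · exact le_rfl
    · simp [hρ, Prod.Lex.toLex_le_toLex, h]
  simp [this, le_iff_lt_or_eq]

/-- With `w` ranked last it loses all ties, and its rank cell is the open cell. -/
theorem Unbeatable.area_half_openCell {R : Rect} {W : Finset (ℝ × ℝ)}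
    (hW : (W : Set (ℝ × ℝ)) ⊆ R.toSet) (hunb : Unbeatable R W) {w : ℝ × ℝ} (hw : w ∈ W)
    (e : Dir) :
    area (openCell R W w ∩ openHalf w e) = 1 / (2 * (W.card : ℝ)) * area R.toSet := by
  classical
  set ρ : ℝ × ℝ → ℕ ×ₗ (ℝ ×ₗ ℝ) := fun q ↦ toLex (if q = w then 1 else 0, toLex q) with hρ
  have hinj : Function.Injective ρ := fun p q h ↦ by
    simpa using (Prod.ext_iff.1 (toLex.injective h)).2
  rw [← hunb.area_half_rankCell hW hinj hw e]
  congr 2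
  ext x
  refine and_congr_right fun _ ↦ forall₂_congr fun q hq ↦ ?_
  rcases eq_or_ne q w with rfl | h
  · simp
  · have : ¬ ρ w ≤ ρ q := by
      simp [hρ, Prod.Lex.toLex_le_toLex, h]
    simp [this, h]

theorem Unbeatable.area_halfCell {R : Rect} {W : Finset (ℝ × ℝ)}
    (hW : (W : Set (ℝ × ℝ)) ⊆ R.toSet) (hunb : Unbeatable R W) {w : ℝ × ℝ} (hw : w ∈ W)
    (e : Dir) :
    area (halfCell R W w e) = 1 / (2 * (W.card : ℝ)) * area R.toSet := by
  have h0 : halfCell R W w e = cell R W w ∩ {x | 0 ≤ offset w e x} := rfl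
  rw [h0, area_inter_offset_nonneg]
  refine le_antisymm ?_ ?_
  · rw [← hunb.area_half_closedCell hW hw e]
    exact R.area_mono (inter_subset_left.trans (closedCell_subset R W w))
      (inter_subset_inter_left _ (cell_subset_closedCell R W w))
  · rw [← hunb.area_half_openCell hW hw e]
    exact R.area_mono (fun x hx ↦ hx.1.1)
      (inter_subset_inter_left _ (openCell_subset_cell R W w))

/-! ### The capture of a single black point -/

/-- In the direction from `p` to `q` in which they are further apart, every point behind `p` is
at least as close to `p` as to `q`. -/
theorem exists_dominant_dir {p q : ℝ × ℝ} (h : q ≠ p) : ∃ e : Dir, 0 < offset p e q ∧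
    dM (p + offset p e q • e.vec) q ≤ offset p e q ∧
    ∀ x, offset p e x ≤ 0 → dM x p ≤ dM x q := by
  have h0 : 0 < |q.1 - p.1| ∨ 0 < |q.2 - p.2| := by
    by_contra! hc
    exact h (Prod.ext (sub_eq_zero.1 (abs_nonpos_iff.1 hc.1))
      (sub_eq_zero.1 (abs_nonpos_iff.1 hc.2)))
  rcases le_total |q.1 - p.1| |q.2 - p.2| with hle | hle
  · have hpos : 0 < |q.2 - p.2| := h0.elim (fun h ↦ h.trans_le hle) id
    rcases le_total 0 (q.2 - p.2) with hs | hs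
    · rw [abs_of_nonneg hs] at hle hpos
      refine ⟨.up, by simpa [offset, Dir.vec] using hpos, ?_, fun x hx ↦ ?_⟩
      · simpa [offset, Dir.vec, dM, deltaX, deltaY, abs_sub_comm] using hle
      · simp [offset, Dir.vec] at hx
        simp only [dM, deltaX, deltaY]
        rw [abs_of_nonpos (by linarith : x.2 - p.2 ≤ 0),
          abs_of_nonpos (by linarith : x.2 - q.2 ≤ 0)]
        have := abs_sub_le x.1 q.1 p.1
        linarith
    · rw [abs_of_nonpos hs] at hle hpos
      refine ⟨.down, by simpa [offset, Dir.vec] using hpos, ?_, fun x hx ↦ ?_⟩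
      · simpa [offset, Dir.vec, dM, deltaX, deltaY, abs_sub_comm] using hle
      · simp [offset, Dir.vec] at hx
        simp only [dM, deltaX, deltaY]
        rw [abs_of_nonneg (by linarith : 0 ≤ x.2 - p.2),
          abs_of_nonneg (by linarith : 0 ≤ x.2 - q.2)]
        have := abs_sub_le x.1 q.1 p.1
        linarith
  · have hpos : 0 < |q.1 - p.1| := h0.elim id (fun h ↦ h.trans_le hle)
    rcases le_total 0 (q.1 - p.1) with hs | hs
    · rw [abs_of_nonneg hs] at hle hpos
      refine ⟨.right, by simpa [offset, Dir.vec] using hpos, ?_, fun x hx ↦ ?_⟩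
      · simpa [offset, Dir.vec, dM, deltaX, deltaY, abs_sub_comm] using hle
      · simp [offset, Dir.vec] at hx
        simp only [dM, deltaX, deltaY]
        rw [abs_of_nonpos (by linarith : x.1 - p.1 ≤ 0),
          abs_of_nonpos (by linarith : x.1 - q.1 ≤ 0)]
        have := abs_sub_le x.2 q.2 p.2
        linarith
    · rw [abs_of_nonpos hs] at hle hpos
      refine ⟨.left, by simpa [offset, Dir.vec] using hpos, ?_, fun x hx ↦ ?_⟩
      · simpa [offset, Dir.vec, dM, deltaX, deltaY, abs_sub_comm] using hle
      · simp [offset, Dir.vec] at hx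
        simp only [dM, deltaX, deltaY]
        rw [abs_of_nonneg (by linarith : 0 ≤ x.1 - p.1),
          abs_of_nonneg (by linarith : 0 ≤ x.1 - q.1)]
        have := abs_sub_le x.2 q.2 p.2
        linarith

/-- A single black point captures at most as much as a half cell. -/
theorem Unbeatable.area_captured_singleton_le {R : Rect} {W : Finset (ℝ × ℝ)}
    (hW : (W : Set (ℝ × ℝ)) ⊆ R.toSet) (hunb : Unbeatable R W) (hne : W.Nonempty) {b : ℝ × ℝ}
    (hb : b ∈ R.toSet) (hbW : b ∉ W) :
    area (captured R W {b}) ≤ 1 / (2 * (W.card : ℝ)) * area R.toSet := by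
  classical
  obtain ⟨w, hw⟩ := hne
  have hdir : ∀ q : ℝ × ℝ, ∃ e : Dir, q ∈ W → ∀ x, offset q e x ≤ 0 → dM x q ≤ dM x b := by
    intro q
    by_cases hq : q ∈ W
    · obtain ⟨e, -, -, he⟩ := exists_dominant_dir (p := q) (q := b) (fun h ↦ hbW (h ▸ hq))
      exact ⟨e, fun _ ↦ he⟩
    · exact ⟨.up, fun h ↦ (hq h).elim⟩
  choose ε hε using hdir
  -- One black point is `b`; the other `n - 1` take, in every cell but that of `w`, the half facing
  -- away from `b`, where `b` captures nothing.
  have h1 := hunb.two_mul_sum_le hW (B := {b}) (by simpa using hb) (by simpa using hbW) (W.erase w)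
    id (fun q ↦ (ε q).opp) (fun q ↦ openCell R W q ∩ openHalf q (ε q).opp)
    (fun q hq ↦ Finset.mem_of_mem_erase hq)
    (fun q hq ↦ inter_subset_inter_left _ (openCell_subset_closedCell R W q))
    (fun q hq ↦ (measurableSet_openCell R W q).inter (measurableSet_openHalf _ _)) ?_ ?_ ?_
  · rw [Finset.sum_congr rfl fun q hq ↦
      hunb.area_half_openCell hW (Finset.mem_of_mem_erase hq) _, Finset.sum_const,
      Finset.card_erase_of_mem hw, nsmul_eq_mul] at h1
    have hn : 1 ≤ W.card := Finset.card_pos.2 ⟨w, hw⟩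
    have hn' : (1 : ℝ) ≤ W.card := by exact_mod_cast hn
    rw [Nat.cast_sub hn, Nat.cast_one] at h1
    have h2 : 2 * ((W.card : ℝ) * (1 / (2 * (W.card : ℝ)) * area R.toSet)) = area R.toSet := by
      field_simp
    nlinarith
  · intro p hp q hq hpq
    refine Disjoint.mono inter_subset_left inter_subset_left (Set.disjoint_left.2 ?_)
    intro x hx hx'
    exact lt_asymm (hx.2 q (Finset.mem_of_mem_erase hq) hpq.symm)
      (hx'.2 p (Finset.mem_of_mem_erase hp) hpq)
  · intro q hq
    rw [Set.disjoint_left]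
    rintro x ⟨-, b', hb', hx⟩ ⟨-, hx' : 0 < offset q (ε q).opp x⟩
    obtain rfl := Finset.mem_singleton.1 hb'
    rw [offset_opp] at hx'
    have hqW := Finset.mem_of_mem_erase hq
    exact (hx q hqW).not_ge (hε q hqW x (by linarith))
  · rw [Finset.card_singleton, Finset.card_erase_of_mem hw]
    have := Finset.card_pos.2 ⟨w, hw⟩
    omega

/-! ### Capturing with a point next to the origin -/

theorem dM_triangle (x y z : ℝ × ℝ) : dM x z ≤ dM x y + dM y z := by
  have h1 := abs_sub_le x.1 y.1 z.1
  have h2 := abs_sub_le x.2 y.2 z.2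
  simp only [dM, deltaX, deltaY]
  linarith

/-- Open cells are closed under passing to a point of a shortest path to `w`. In particular, they
project onto the axes through `w`, so the arms bound the extent of the cell. -/
theorem mem_openCell_of_between {R : Rect} {W : Finset (ℝ × ℝ)} {w x y : ℝ × ℝ}
    (hx : x ∈ openCell R W w) (hy : y ∈ R.toSet) (h : dM x y + dM y w = dM x w) :
    y ∈ openCell R W w := ⟨hy, fun q hq hqw ↦ by
  have h1 := hx.2 q hq hqw
  have h2 := dM_triangle x y q
  linarith⟩

theorem mem_captured_singleton {R : Rect} {W : Finset (ℝ × ℝ)} {b x : ℝ × ℝ} :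
    x ∈ captured R W {b} ↔ x ∈ R.toSet ∧ ∀ q ∈ W, dM x b < dM x q := by
  simp [captured]

theorem mem_captured_of_mem_closedCell {R : Rect} {W : Finset (ℝ × ℝ)} {w b x : ℝ × ℝ}
    (hx : x ∈ closedCell R W w) (h : dM x b < dM x w) : x ∈ captured R W {b} :=
  mem_captured_singleton.2 ⟨hx.1, fun q hq ↦ h.trans_le (hx.2 q hq)⟩

theorem dM_zero (x : ℝ × ℝ) : dM x 0 = |x.1| + |x.2| := by simp [dM, deltaX, deltaY]

theorem dM_mk (x : ℝ × ℝ) (a b : ℝ) : dM x (a, b) = |x.1 - a| + |x.2 - b| := rfl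

/-- A point `x` of the open upper right quadrant above a point of the closed cell of the origin is
captured by `(t₁, t₂)`. -/
theorem mem_captured_of_above {R : Rect} {W : Finset (ℝ × ℝ)} {t₁ t₂ α m σ : ℝ} {x : ℝ × ℝ}
    (ht₁ : 0 ≤ t₁) (hm : t₂ - t₁ < m)
    (hα : ∀ q ∈ W, q ≠ 0 → α + m ≤ dM (α, 0) q) (hx : x ∈ R.toSet) (hx1 : t₁ ≤ x.1)
    (hxα : x.1 ≤ α) (hx2 : 0 < x.2) (hxη : t₂ - t₁ < 2 * x.2)
    (hσ : 0 ≤ σ) (hσt : 2 * σ < t₁ + t₂) (hσx : σ ≤ x.2)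
    (hz : (x.1, x.2 - σ) ∈ closedCell R W 0) : x ∈ captured R W {(t₁, t₂)} := by
  refine mem_captured_singleton.2 ⟨hx, fun q hq ↦ ?_⟩
  have h1 : |x.1 - t₁| = x.1 - t₁ := abs_of_nonneg (by linarith)
  have h2 : |x.1| = x.1 := abs_of_nonneg (by linarith)
  have h3 : |x.2| = x.2 := abs_of_pos hx2
  have h0 : dM x (t₁, t₂) < dM x 0 := by
    rw [dM_mk, dM_zero, h1, h2, h3]
    rcases abs_cases (x.2 - t₂) with h | h <;> linarith
  rcases eq_or_ne q 0 with rfl | hq0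
  · exact h0
  -- Above the height of the black point: `q` is no nearer to `(x.1, x.2 - σ)` than the origin,
  -- hence at distance at least `x.1 + x.2 - 2 * σ` from `x`, while the black point is at `x.1 + x.2
  -- - (t₁ + t₂)`.
  rcases le_total t₂ x.2 with hle | hle
  · have h4 := hz.2 q hq
    have h5 := dM_triangle (x.1, x.2 - σ) x q
    have h6 : dM (x.1, x.2 - σ) x = σ := by
      simp [dM, deltaX, deltaY, abs_of_nonneg hσ]
    have h7 : dM (x.1, x.2 - σ) 0 = x.1 + x.2 - σ := by
      rw [dM_zero]
      simp only [h2, abs_of_nonneg (by linarith : 0 ≤ x.2 - σ)]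
      ring
    rw [dM_mk, h1, abs_of_nonneg (by linarith : 0 ≤ x.2 - t₂)]
    linarith
  -- Below that height: the bound at `(α, 0)` keeps `q` at distance at least `x.1 - x.2 + m` from
  -- `x`, while the black point is at `x.1 - x.2 + (t₂ - t₁)`.
  · have h4 := hα q hq hq0
    have h5 := dM_triangle (α, 0) x q
    have h6 : dM (α, 0) x = α - x.1 + x.2 := by
      simp only [dM, deltaX, deltaY, zero_sub, abs_neg, h3]
      rw [abs_of_nonneg (by linarith)]
    rw [dM_mk, h1, abs_of_nonpos (by linarith : x.2 - t₂ ≤ 0)]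
    linarith

/-- This is the gain in the quadrant. Over the columns from `t` to `α`, the black point captures the
cell translated upwards by `s` (`A1`) and almost all of the strip thus vacated (`A2`); `hu` keeps
the translate inside the rectangle. The rest of the cell is retained (`A3`, `A4`) except for two
strips of width `η` and a square of side `t`. In the applications `s = t - t ^ 2` and `η = t ^ 2`,
so the gain is `α * t` up to second order. -/
theorem area_upperRight_le {R : Rect} {W : Finset (ℝ × ℝ)} {t₁ t₂ t η s α m D : ℝ}
    (hR : (0 : ℝ × ℝ) ∈ R.toSet) (hη : 0 < η) (hη₁ : t₁ - t₂ ≤ η) (hη₂ : t₂ - t₁ ≤ η)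
    (ht₁ : 0 ≤ t₁) (ht₁t : t₁ ≤ t) (ht₂t : t₂ ≤ t) (hηs : η ≤ s)
    (hs : 2 * s < t₁ + t₂) (htα : t ≤ α) (hαR : α ≤ R.right) (hm0 : 0 ≤ m) (hm : t₂ - t₁ < m)
    (hα : ∀ q ∈ W, q ≠ 0 → α + m ≤ dM (α, 0) q) (hsR : s ≤ R.top)
    (hu : ∀ y : ℝ, 0 ≤ y → (0, y) ∈ openCell R W 0 → y + s ≤ R.top)
    (hD1 : R.right ≤ D) (hD2 : R.top ≤ D) :
    area (openCell R W 0 ∩ {x | 0 < x.1 ∧ 0 < x.2}) + (α - t) * (s - η) ≤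
      area (captured R W {(t₁, t₂)} ∩ {x | 0 < x.1 ∧ 0 < x.2}) + (2 * η * D + t ^ 2) := by
  set K := openCell R W 0 ∩ {x | 0 < x.1 ∧ 0 < x.2} with hK
  have hRm := Rect.mem_toSet.1 hR
  simp only [Prod.fst_zero, Prod.snd_zero] at hRm
  have hm1 : Measurable fun x : ℝ × ℝ ↦ x.1 := measurable_fst
  have hm2 : Measurable fun x : ℝ × ℝ ↦ x.2 := measurable_snd
  have hKm : MeasurableSet K := (measurableSet_openCell _ _ _).inter
    ((measurableSet_lt measurable_const hm1).inter (measurableSet_lt measurable_const hm2))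
  have hKR : K ⊆ R.toSet := fun x hx ↦ hx.1.1
  set K1 := K ∩ {x | t ≤ x.1 ∧ x.1 < α} with hK1
  set K2 := K ∩ {x | x.1 < t} with hK2
  set K3 := K ∩ {x | α ≤ x.1} with hK3
  have hK1m : MeasurableSet K1 := hKm.inter
    ((measurableSet_le measurable_const hm1).inter (measurableSet_lt hm1 measurable_const))
  set A1 : Set (ℝ × ℝ) := (fun x ↦ x - (0, s)) ⁻¹' K1 with hA1
  set A2 : Set (ℝ × ℝ) := Ico t α ×ˢ Ioc η s with hA2
  set A3 := K ∩ {x | α ≤ x.1 ∧ η < x.2} with hA3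
  set A4 := K ∩ {x | η < x.1 ∧ x.1 < t ∧ t ≤ x.2} with hA4
  have hA2m : MeasurableSet A2 := measurableSet_Ico.prod measurableSet_Ioc
  have hA3m : MeasurableSet A3 := hKm.inter
    ((measurableSet_le measurable_const hm1).inter (measurableSet_lt measurable_const hm2))
  have hA4m : MeasurableSet A4 := hKm.inter ((measurableSet_lt measurable_const hm1).inter
    ((measurableSet_lt hm1 measurable_const).inter (measurableSet_le measurable_const hm2)))
  set T := captured R W {(t₁, t₂)} ∩ {x | 0 < x.1 ∧ 0 < x.2} with hT
  have hTR : T ⊆ R.toSet := fun x hx ↦ hx.1.1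
  have hclosed : ∀ x ∈ K, x ∈ closedCell R W 0 := fun x hx ↦
    openCell_subset_closedCell R W 0 hx.1
  have htop : ∀ x ∈ K, x.2 + s ≤ R.top := by
    intro x hx
    have hxR := Rect.mem_toSet.1 (hKR hx)
    have hx0 : 0 < x.1 ∧ 0 < x.2 := hx.2
    refine hu x.2 hx0.2.le (mem_openCell_of_between hx.1 (Rect.mem_toSet.2 ?_) ?_)
    · exact ⟨⟨hRm.1.1, hRm.1.2⟩, hxR.2.1, hxR.2.2⟩
    · rw [dM_mk, dM_zero, dM_zero]; simp
  -- the captured pieces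
  have hA1T : A1 ⊆ T := by
    intro x hx
    obtain ⟨hxK, hxt, hxα⟩ := hx
    have hxR := Rect.mem_toSet.1 (hKR hxK)
    have hxs := htop _ hxK
    have hxp := hxK.2
    simp only [Prod.fst_sub, Prod.snd_sub, sub_zero, mem_ofPred_eq] at hxt hxα hxR hxs hxp
    refine ⟨mem_captured_of_above (σ := s) ht₁ hm hα ?_ (by linarith) hxα.le (by linarith)
      (by linarith) (by linarith) hs (by linarith) ?_, hxp.1, by linarith⟩
    · exact Rect.mem_toSet.2 ⟨hxR.1, by linarith, by linarith⟩
    · have h1 : (x.1, x.2 - s) = x - (0, s) := by ext <;> simp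
      rw [h1]
      exact hclosed _ hxK
  have hA2T : A2 ⊆ T := by
    rintro x ⟨⟨hxt, hxα⟩, hxη, hxs⟩
    have hxR : x ∈ R.toSet :=
      Rect.mem_toSet.2 ⟨⟨by linarith, by linarith⟩, by linarith, by linarith⟩
    have hpos : 0 < x.1 := by linarith
    refine ⟨mem_captured_of_above (σ := x.2) ht₁ hm hα hxR (by linarith) hxα.le (by linarith)
      (by linarith) (by linarith) (by linarith) le_rfl ?_, hpos, by linarith⟩
    refine ⟨Rect.mem_toSet.2 ⟨⟨by simp; linarith, by simp; linarith⟩, by simpa using hRm.2.1,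
      by simpa using hRm.2.2⟩, fun q hq ↦ ?_⟩
    rcases eq_or_ne q 0 with rfl | hq0
    · exact le_rfl
    have h1 := hα q hq hq0
    have h2 := dM_triangle (α, 0) (x.1, x.2 - x.2) q
    have h3 : dM (α, 0) (x.1, x.2 - x.2) = α - x.1 := by
      simp [dM, deltaX, deltaY, abs_of_nonneg (by linarith : 0 ≤ α - x.1)]
    have h4 : dM (x.1, x.2 - x.2) 0 = x.1 := by
      simp [dM_zero, abs_of_pos hpos]
    linarith
  have hA3T : A3 ⊆ T := by
    rintro x ⟨hxK, hxα, hxη⟩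
    refine ⟨mem_captured_of_mem_closedCell (hclosed x hxK) ?_, hxK.2⟩
    have hx0 : 0 < x.1 ∧ 0 < x.2 := hxK.2
    rw [dM_mk, dM_zero, abs_of_pos hx0.1, abs_of_pos hx0.2,
      abs_of_nonneg (by linarith : 0 ≤ x.1 - t₁)]
    rcases abs_cases (x.2 - t₂) with h | h <;> linarith
  have hA4T : A4 ⊆ T := by
    rintro x ⟨hxK, hxη, hxt, hxt2⟩
    refine ⟨mem_captured_of_mem_closedCell (hclosed x hxK) ?_, hxK.2⟩
    have hx0 : 0 < x.1 ∧ 0 < x.2 := hxK.2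
    rw [dM_mk, dM_zero, abs_of_pos hx0.1, abs_of_pos hx0.2,
      abs_of_nonneg (by linarith : 0 ≤ x.2 - t₂)]
    rcases abs_cases (x.1 - t₁) with h | h <;> linarith
  -- their areas
  have hA1a : area A1 = area K1 := by
    simp only [area, Measure.real]
    simp only [hA1, sub_eq_add_neg, measure_preimage_add_right]
  have hA2a : area A2 = (α - t) * (s - η) := by
    rw [area, Measure.volume_eq_prod, measureReal_prod_prod, Real.volume_real_Ico_of_le htα,
      Real.volume_real_Ioc_of_le hηs]
  have hA3a : area K3 ≤ area A3 + D * η := by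
    have h1 : K3 ⊆ A3 ∪ Icc 0 D ×ˢ Icc 0 η := by
      rintro x ⟨hxK, hxα⟩
      have hx0 : 0 < x.1 ∧ 0 < x.2 := hxK.2
      have hxR := Rect.mem_toSet.1 (hKR hxK)
      rcases lt_or_ge η x.2 with h | h
      · exact Or.inl ⟨hxK, hxα, h⟩
      · exact Or.inr ⟨⟨hx0.1.le, by linarith⟩, hx0.2.le, h⟩
    have h2 : area K3 ≤ area (A3 ∪ Icc 0 D ×ˢ Icc 0 η) := by
      refine measureReal_mono h1 (measure_union_ne_top ?_ ?_)
      · exact Rect.volume_ne_top (hA3T.trans hTR)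
      · exact (isCompact_Icc.prod isCompact_Icc).measure_lt_top.ne
    have h3 := area_union_le A3 (Icc 0 D ×ˢ Icc 0 η)
    rw [area_prod_Icc (by linarith) hη.le] at h3
    linarith
  have hA4a : area K2 ≤ area A4 + (η * D + t * t) := by
    have h1 : K2 ⊆ A4 ∪ (Icc 0 η ×ˢ Icc 0 D ∪ Icc 0 t ×ˢ Icc 0 t) := by
      rintro x ⟨hxK, hxt⟩
      have hx0 : 0 < x.1 ∧ 0 < x.2 := hxK.2
      have hxt : x.1 < t := hxt
      have hxR := Rect.mem_toSet.1 (hKR hxK)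
      rcases lt_or_ge η x.1 with h | h
      · rcases le_or_gt t x.2 with h' | h'
        · exact Or.inl ⟨hxK, h, hxt, h'⟩
        · exact Or.inr (Or.inr ⟨⟨hx0.1.le, hxt.le⟩, hx0.2.le, h'.le⟩)
      · exact Or.inr (Or.inl ⟨⟨hx0.1.le, h⟩, hx0.2.le, by linarith⟩)
    have h2 : area K2 ≤ area (A4 ∪ (Icc 0 η ×ˢ Icc 0 D ∪ Icc 0 t ×ˢ Icc 0 t)) := by
      refine measureReal_mono h1 (measure_union_ne_top ?_ (measure_union_ne_top ?_ ?_))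
      · exact Rect.volume_ne_top (hA4T.trans hTR)
      · exact (isCompact_Icc.prod isCompact_Icc).measure_lt_top.ne
      · exact (isCompact_Icc.prod isCompact_Icc).measure_lt_top.ne
    have h3 := area_union_le A4 (Icc 0 η ×ˢ Icc 0 D ∪ Icc 0 t ×ˢ Icc 0 t)
    have h4 := area_union_le (Icc 0 η ×ˢ Icc 0 D) (Icc 0 t ×ˢ Icc 0 t)
    rw [area_prod_Icc hη.le (by linarith), area_prod_Icc (by linarith) (by linarith)] at h4
    linarith
  have hKa : area K ≤ area K2 + (area K1 + area K3) := by
    have h1 : K ⊆ K2 ∪ (K1 ∪ K3) := by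
      intro x hx
      rcases lt_or_ge x.1 t with h | h
      · exact Or.inl ⟨hx, h⟩
      · rcases lt_or_ge x.1 α with h' | h'
        · exact Or.inr (Or.inl ⟨hx, h, h'⟩)
        · exact Or.inr (Or.inr ⟨hx, h'⟩)
    have h2 := R.area_mono (union_subset (inter_subset_left.trans hKR)
      (union_subset (inter_subset_left.trans hKR) (inter_subset_left.trans hKR))) h1
    have h3 := area_union_le K2 (K1 ∪ K3)
    have h4 := area_union_le K1 K3
    linarith
  have hTa : area A4 + (area A3 + (area A1 + area A2)) ≤ area T := by
    have h12 : Disjoint A1 A2 := by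
      rw [Set.disjoint_left]
      intro x hx hx'
      have h1 := hx.1.2.2
      have h2 := hx'.2.2
      simp only [Prod.snd_sub] at h1
      linarith
    have h3 : Disjoint A3 (A1 ∪ A2) := by
      rw [Set.disjoint_left]
      rintro x hx (hx' | hx')
      · have h1 := hx'.2.2
        simp only [Prod.fst_sub, sub_zero] at h1
        exact h1.not_ge hx.2.1
      · exact hx'.1.2.not_ge hx.2.1
    have h4 : Disjoint A4 (A3 ∪ (A1 ∪ A2)) := by
      rw [Set.disjoint_left]
      rintro x hx (hx' | hx' | hx')
      · exact (hx.2.2.1.trans_le htα).not_ge hx'.2.1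
      · have h1 := hx'.2.1
        simp only [Prod.fst_sub, sub_zero] at h1
        exact hx.2.2.1.not_ge h1
      · exact hx.2.2.1.not_ge hx'.1.1
    have hA1m : MeasurableSet A1 := hK1m.preimage (measurable_id.sub_const _)
    have s12 := union_subset hA1T hA2T
    have s3 := union_subset hA3T s12
    rw [← R.area_union (hA1T.trans hTR) (hA2T.trans hTR) h12 hA2m,
      ← R.area_union (hA3T.trans hTR) (s12.trans hTR) h3 (hA1m.union hA2m),
      ← R.area_union (hA4T.trans hTR) (s3.trans hTR) h4 (hA3m.union (hA1m.union hA2m))]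
    exact R.area_mono hTR (union_subset hA4T s3)
  nlinarith

theorem add_area_le_of_disjoint {R : Rect} {S P Q : Set (ℝ × ℝ)} (hS : S ⊆ R.toSet)
    (hPQ : Disjoint P Q) (hm : MeasurableSet (S ∩ Q)) :
    area (S ∩ P) + area (S ∩ Q) ≤ area S := by
  rw [← R.area_union (inter_subset_left.trans hS) (inter_subset_left.trans hS)
    (hPQ.mono inter_subset_right inter_subset_right) hm]
  exact R.area_mono hS (union_subset inter_subset_left inter_subset_left)

/-- If the upper arm of the origin does not reach the boundary, then the right arm (even the one
in the closed cell) is not longer than the lower arm. -/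
theorem right_le_down {R : Rect} {W : Finset (ℝ × ℝ)} (hleft : R.left ≤ 0) (hright : 0 < R.right)
    (hbot : R.bottom ≤ 0) (htop : 0 < R.top) {A : ℝ}
    (hA : ∀ b ∈ R.toSet, b ∉ W → area (captured R W {b}) ≤ A)
    (hA' : area (openCell R W 0 ∩ {x | 0 < x.1}) = A) {u δ α : ℝ} (huR : u < R.top)
    (hu : ∀ y : ℝ, 0 ≤ y → (0, y) ∈ openCell R W 0 → y ≤ u) (hδ0 : 0 ≤ δ)
    (hδ : ∀ y : ℝ, 0 ≤ y → (0, -y) ∈ openCell R W 0 → y ≤ δ)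
    (hα : (α, 0) ∈ closedCell R W 0) : α ≤ δ := by
  rcases le_or_gt α 0 with hα0 | hα0
  · exact hα0.trans hδ0
  have hαR := (Rect.mem_toSet.1 hα.1).1.2
  simp only at hαR
  set D := max R.right R.top with hD
  have hαq : ∀ q ∈ W, q ≠ 0 → α + 0 ≤ dM (α, 0) q := by
    intro q hq _
    have := hα.2 q hq
    rw [dM_zero, abs_of_pos hα0] at this
    simpa using this
  -- The black point is `(t, t - t ^ 2)`. Being strictly below the diagonal, it beats the origin in
  -- the lower right quadrant to the right of `t`, and the tie at `(α, 0)` allowed by the closed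
  -- cell does no harm (`m = 0`). The shift is of second order and disappears after division by `t`.
  have key : ∀ᶠ t : ℝ in 𝓝[>] 0, (α - t) * (1 - 2 * t) ≤ t * (2 * D + 1) + δ := by
    have e1 : ∀ᶠ t : ℝ in 𝓝[>] 0, t < 1 / 2 := nhdsWithin_le_nhds (eventually_lt_nhds (by norm_num))
    have e2 : ∀ᶠ t : ℝ in 𝓝[>] 0, t < α := nhdsWithin_le_nhds (eventually_lt_nhds hα0)
    have e3 : ∀ᶠ t : ℝ in 𝓝[>] 0, t < R.top - u :=
      nhdsWithin_le_nhds (eventually_lt_nhds (by linarith))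
    have e4 : ∀ᶠ t : ℝ in 𝓝[>] 0, t < R.top := nhdsWithin_le_nhds (eventually_lt_nhds htop)
    have e5 : ∀ᶠ t : ℝ in 𝓝[>] 0, (t, t - t ^ 2) ∉ W.erase 0 := by
      have h1 : ContinuousAt (fun t : ℝ ↦ (t, t - t ^ 2)) 0 := by fun_prop
      have h2 : ∀ᶠ y in 𝓝 (((0 : ℝ), (0 : ℝ) - 0 ^ 2)), y ∉ W.erase 0 :=
        (Finset.finite_toSet _).isClosed.isOpen_compl.mem_nhds (by simp)
      exact nhdsWithin_le_nhds (h1.eventually h2)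
    filter_upwards [e1, e2, e3, e4, e5, self_mem_nhdsWithin] with t h1 h2 h3 h4 h5 ht
    have ht : 0 < t := ht
    have ht2 : 0 < t ^ 2 := by positivity
    have ht3 : t ^ 2 < t / 2 := by nlinarith
    have hbW : (t, t - t ^ 2) ∉ W := fun h ↦ h5 (Finset.mem_erase.2 ⟨by
      simp [Prod.ext_iff, ht.ne'], h⟩)
    have hbR : (t, t - t ^ 2) ∈ R.toSet :=
      Rect.mem_toSet.2 ⟨⟨by simp; linarith, by simp; linarith⟩, by simp; linarith, by simp; linarith⟩
    have h6 := hA _ hbR hbW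
    have h7 := area_upperRight_le (R := R) (W := W) (t₁ := t) (t₂ := t - t ^ 2) (t := t)
      (η := t ^ 2) (s := t - t ^ 2) (α := α) (m := 0) (D := D)
      (Rect.mem_toSet.2 ⟨⟨hleft, hright.le⟩, hbot, htop.le⟩) ht2 (by linarith) (by linarith) ht.le
      le_rfl (by linarith) (by linarith) (by linarith) h2.le hαR le_rfl
      (by linarith) hαq (by linarith) (fun y hy hyU ↦ by have := hu y hy hyU; linarith)
      (le_max_left _ _) (le_max_right _ _)
    have hm1 : Measurable fun x : ℝ × ℝ ↦ x.1 := measurable_fst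
    have hm2 : Measurable fun x : ℝ × ℝ ↦ x.2 := measurable_snd
    set C := captured R W {(t, t - t ^ 2)} with hC
    have h8 := add_area_le_of_disjoint (captured_subset R W {(t, t - t ^ 2)})
      (P := {x | 0 < x.1 ∧ 0 < x.2}) (Q := {x | 0 < x.1 ∧ x.2 ≤ 0})
      (Set.disjoint_left.2 fun x hx hx' ↦ hx'.2.not_gt hx.2)
      ((measurableSet_captured _ _ _).inter
        ((measurableSet_lt measurable_const hm1).inter (measurableSet_le hm2 measurable_const)))
    -- Only a strip of width `t` can be lost here; projection to the vertical axis bounds its depth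
    -- by the lower arm.
    have h9 : area (openCell R W 0 ∩ {x | 0 < x.1 ∧ x.2 ≤ 0}) ≤
        area (C ∩ {x | 0 < x.1 ∧ x.2 ≤ 0}) + t * δ := by
      have i1 : openCell R W 0 ∩ {x | 0 < x.1 ∧ x.2 ≤ 0} ⊆
          (C ∩ {x | 0 < x.1 ∧ x.2 ≤ 0}) ∪ Icc 0 t ×ˢ Icc (-δ) 0 := by
        rintro x ⟨hx, hx1, hx2⟩
        rcases lt_or_ge t x.1 with hlt | hge
        · refine Or.inl ⟨mem_captured_of_mem_closedCell
            (openCell_subset_closedCell R W 0 hx) ?_, hx1, hx2⟩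
          rw [dM_mk, dM_zero, abs_of_pos hx1, abs_of_nonpos hx2,
            abs_of_pos (by linarith : 0 < x.1 - t),
            abs_of_nonpos (by linarith : x.2 - (t - t ^ 2) ≤ 0)]
          linarith
        · have hxR := Rect.mem_toSet.1 hx.1
          have j1 : (0, -(-x.2)) ∈ openCell R W 0 := by
            rw [neg_neg]
            refine mem_openCell_of_between hx (Rect.mem_toSet.2 ?_) ?_
            · exact ⟨⟨hleft, hright.le⟩, hxR.2.1, hxR.2.2⟩
            · rw [dM_mk, dM_zero, dM_zero]; simp
          have j2 := hδ (-x.2) (by linarith) j1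
          exact Or.inr ⟨⟨hx1.le, hge⟩, by linarith, hx2⟩
      have i2 := measureReal_mono (μ := (volume : Measure (ℝ × ℝ))) i1 (measure_union_ne_top
        (Rect.volume_ne_top (inter_subset_left.trans (captured_subset R W _)))
        (isCompact_Icc.prod isCompact_Icc).measure_lt_top.ne)
      have i3 := area_union_le (C ∩ {x | 0 < x.1 ∧ x.2 ≤ 0}) (Icc 0 t ×ˢ Icc (-δ) 0)
      rw [area_prod_Icc ht.le (by linarith)] at i3
      unfold area at *
      linarith
    have h10 : A ≤ area (openCell R W 0 ∩ {x | 0 < x.1 ∧ 0 < x.2}) +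
        area (openCell R W 0 ∩ {x | 0 < x.1 ∧ x.2 ≤ 0}) := by
      rw [← hA']
      refine le_trans (R.area_mono ?_ ?_) (area_union_le _ _)
      · exact union_subset (fun x hx ↦ hx.1.1) (fun x hx ↦ hx.1.1)
      · rintro x ⟨hx, hx1⟩
        rcases lt_or_ge 0 x.2 with h | h
        · exact Or.inl ⟨hx, hx1, h⟩
        · exact Or.inr ⟨hx, hx1, h⟩
    have h11 : (α - t) * (t - t ^ 2 - t ^ 2) ≤ 2 * t ^ 2 * D + t ^ 2 + t * δ := by linarith
    have h12 : t * ((α - t) * (1 - 2 * t)) ≤ t * (t * (2 * D + 1) + δ) := by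
      linarith
    exact le_of_mul_le_mul_left h12 ht
  have l1 : Tendsto (fun t : ℝ ↦ (α - t) * (1 - 2 * t)) (𝓝[>] 0) (𝓝 α) := by
    have : Continuous fun t : ℝ ↦ (α - t) * (1 - 2 * t) := by fun_prop
    simpa using this.continuousWithinAt (s := Ioi 0) (x := 0) |>.tendsto
  have l2 : Tendsto (fun t : ℝ ↦ t * (2 * D + 1) + δ) (𝓝[>] 0) (𝓝 δ) := by
    have : Continuous fun t : ℝ ↦ t * (2 * D + 1) + δ := by fun_prop
    simpa using this.continuousWithinAt (s := Ioi 0) (x := 0) |>.tendsto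
  exact le_of_tendsto_of_tendsto l1 l2 key

/-- If the upper arm of the origin does not reach the boundary, then the right arm is not longer
than the left arm. -/
theorem right_le_left {R : Rect} {W : Finset (ℝ × ℝ)} (hleft : R.left ≤ 0) (hright : 0 < R.right)
    (hbot : R.bottom ≤ 0) (htop : 0 < R.top) {A : ℝ}
    (hA : ∀ b ∈ R.toSet, b ∉ W → area (captured R W {b}) ≤ A)
    (hA' : area (openCell R W 0 ∩ {x | 0 < x.2}) = A) {u δ α : ℝ} (huR : u < R.top)
    (hu : ∀ y : ℝ, 0 ≤ y → (0, y) ∈ openCell R W 0 → y ≤ u) (hδ0 : 0 ≤ δ)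
    (hδ : ∀ y : ℝ, 0 ≤ y → (-y, 0) ∈ openCell R W 0 → y ≤ δ)
    (hα : (α, 0) ∈ openCell R W 0) : α ≤ δ := by
  rcases le_or_gt α 0 with hα0 | hα0
  · exact hα0.trans hδ0
  have hαR := (Rect.mem_toSet.1 hα.1).1.2
  simp only at hαR
  set D := max R.right R.top with hD
  have key : ∀ᶠ t : ℝ in 𝓝[>] 0, (α - t) * (1 - 2 * t) ≤ t * (2 * D + 1) + δ := by
    have e1 : ∀ᶠ t : ℝ in 𝓝[>] 0, t < 1 / 2 := nhdsWithin_le_nhds (eventually_lt_nhds (by norm_num))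
    have e2 : ∀ᶠ t : ℝ in 𝓝[>] 0, t < α := nhdsWithin_le_nhds (eventually_lt_nhds hα0)
    have e3 : ∀ᶠ t : ℝ in 𝓝[>] 0, t < R.top - u :=
      nhdsWithin_le_nhds (eventually_lt_nhds (by linarith))
    have e4 : ∀ᶠ t : ℝ in 𝓝[>] 0, t < R.top := nhdsWithin_le_nhds (eventually_lt_nhds htop)
    have e5 : ∀ᶠ t : ℝ in 𝓝[>] 0, (t - t ^ 2, t) ∉ W.erase 0 := by
      have h1 : ContinuousAt (fun t : ℝ ↦ (t - t ^ 2, t)) 0 := by fun_prop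
      have h2 : ∀ᶠ y in 𝓝 (((0 : ℝ) - 0 ^ 2, (0 : ℝ))), y ∉ W.erase 0 :=
        (Finset.finite_toSet _).isClosed.isOpen_compl.mem_nhds (by simp)
      exact nhdsWithin_le_nhds (h1.eventually h2)
    -- The black point `(t - t ^ 2, t)` must now lie above the diagonal, which costs `t ^ 2` near
    -- the horizontal axis. The strict inequality of the open cell at `(α, 0)` provides the slack `m
    -- = 2 * t ^ 2`.
    have e6 : ∀ᶠ t : ℝ in 𝓝[>] 0, ∀ q ∈ W, q ≠ 0 → α + 2 * t ^ 2 ≤ dM (α, 0) q := by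
      rw [Filter.eventually_all_finset]
      intro q hq
      by_cases hq0 : q = 0
      · exact Eventually.of_forall fun t h ↦ (h hq0).elim
      have h1 : ContinuousAt (fun t : ℝ ↦ α + 2 * t ^ 2) 0 := by fun_prop
      have h2 := hα.2 q hq hq0
      rw [dM_zero, abs_of_pos hα0] at h2
      have h3 : ∀ᶠ t : ℝ in 𝓝 0, α + 2 * t ^ 2 < dM (α, 0) q :=
        h1.eventually_lt_const (by simpa using h2)
      exact nhdsWithin_le_nhds (h3.mono fun t h _ ↦ h.le)
    filter_upwards [e1, e2, e3, e4, e5, e6, self_mem_nhdsWithin] with t h1 h2 h3 h4 h5 hαq ht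
    have ht : 0 < t := ht
    have ht2 : 0 < t ^ 2 := by positivity
    have ht3 : t ^ 2 < t / 2 := by nlinarith
    have hbW : (t - t ^ 2, t) ∉ W := fun h ↦ h5 (Finset.mem_erase.2 ⟨by
      simp [Prod.ext_iff, ht.ne'], h⟩)
    have hbR : (t - t ^ 2, t) ∈ R.toSet :=
      Rect.mem_toSet.2 ⟨⟨by simp; linarith, by simp; linarith⟩, by simp; linarith, by simp; linarith⟩
    have h6 := hA _ hbR hbW
    have h7 := area_upperRight_le (R := R) (W := W) (t₁ := t - t ^ 2) (t₂ := t) (t := t)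
      (η := t ^ 2) (s := t - t ^ 2) (α := α) (m := 2 * t ^ 2) (D := D)
      (Rect.mem_toSet.2 ⟨⟨hleft, hright.le⟩, hbot, htop.le⟩) ht2 (by linarith) (by linarith)
      (by linarith) (by linarith) le_rfl (by linarith) (by linarith) h2.le hαR
      (by positivity) (by linarith) hαq (by linarith)
      (fun y hy hyU ↦ by have := hu y hy hyU; linarith) (le_max_left _ _) (le_max_right _ _)
    have hm1 : Measurable fun x : ℝ × ℝ ↦ x.1 := measurable_fst
    have hm2 : Measurable fun x : ℝ × ℝ ↦ x.2 := measurable_snd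
    set C := captured R W {(t - t ^ 2, t)} with hC
    have h8 := add_area_le_of_disjoint (captured_subset R W {(t - t ^ 2, t)})
      (P := {x | 0 < x.1 ∧ 0 < x.2}) (Q := {x | x.1 ≤ 0 ∧ 0 < x.2})
      (Set.disjoint_left.2 fun x hx hx' ↦ hx'.1.not_gt hx.1)
      ((measurableSet_captured _ _ _).inter
        ((measurableSet_le hm1 measurable_const).inter (measurableSet_lt measurable_const hm2)))
    have h9 : area (openCell R W 0 ∩ {x | x.1 ≤ 0 ∧ 0 < x.2}) ≤
        area (C ∩ {x | x.1 ≤ 0 ∧ 0 < x.2}) + t * δ := by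
      have i1 : openCell R W 0 ∩ {x | x.1 ≤ 0 ∧ 0 < x.2} ⊆
          (C ∩ {x | x.1 ≤ 0 ∧ 0 < x.2}) ∪ Icc (-δ) 0 ×ˢ Icc 0 t := by
        rintro x ⟨hx, hx1, hx2⟩
        rcases lt_or_ge t x.2 with hlt | hge
        · refine Or.inl ⟨mem_captured_of_mem_closedCell
            (openCell_subset_closedCell R W 0 hx) ?_, hx1, hx2⟩
          rw [dM_mk, dM_zero, abs_of_pos hx2, abs_of_nonpos hx1,
            abs_of_pos (by linarith : 0 < x.2 - t),
            abs_of_nonpos (by linarith : x.1 - (t - t ^ 2) ≤ 0)]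
          linarith
        · have hxR := Rect.mem_toSet.1 hx.1
          have j1 : (-(-x.1), 0) ∈ openCell R W 0 := by
            rw [neg_neg]
            refine mem_openCell_of_between hx (Rect.mem_toSet.2 ?_) ?_
            · exact ⟨⟨hxR.1.1, hxR.1.2⟩, hbot, htop.le⟩
            · rw [dM_mk, dM_zero, dM_zero]; simp [add_comm]
          have j2 := hδ (-x.1) (by linarith) j1
          exact Or.inr ⟨⟨by linarith, hx1⟩, hx2.le, hge⟩
      have i2 := measureReal_mono (μ := (volume : Measure (ℝ × ℝ))) i1 (measure_union_ne_top
        (Rect.volume_ne_top (inter_subset_left.trans (captured_subset R W _)))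
        (isCompact_Icc.prod isCompact_Icc).measure_lt_top.ne)
      have i3 := area_union_le (C ∩ {x | x.1 ≤ 0 ∧ 0 < x.2}) (Icc (-δ) 0 ×ˢ Icc 0 t)
      rw [area_prod_Icc (by linarith) ht.le] at i3
      unfold area at *
      linarith
    have h10 : A ≤ area (openCell R W 0 ∩ {x | 0 < x.1 ∧ 0 < x.2}) +
        area (openCell R W 0 ∩ {x | x.1 ≤ 0 ∧ 0 < x.2}) := by
      rw [← hA']
      refine le_trans (R.area_mono ?_ ?_) (area_union_le _ _)
      · exact union_subset (fun x hx ↦ hx.1.1) (fun x hx ↦ hx.1.1)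
      · rintro x ⟨hx, hx2⟩
        rcases lt_or_ge 0 x.1 with h | h
        · exact Or.inl ⟨hx, h, hx2⟩
        · exact Or.inr ⟨hx, h, hx2⟩
    have h11 : (α - t) * (t - t ^ 2 - t ^ 2) ≤ 2 * t ^ 2 * D + t ^ 2 + t * δ := by linarith
    have h12 : t * ((α - t) * (1 - 2 * t)) ≤ t * (t * (2 * D + 1) + δ) := by
      linarith
    exact le_of_mul_le_mul_left h12 ht
  have l1 : Tendsto (fun t : ℝ ↦ (α - t) * (1 - 2 * t)) (𝓝[>] 0) (𝓝 α) := by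
    have : Continuous fun t : ℝ ↦ (α - t) * (1 - 2 * t) := by fun_prop
    simpa using this.continuousWithinAt (s := Ioi 0) (x := 0) |>.tendsto
  have l2 : Tendsto (fun t : ℝ ↦ t * (2 * D + 1) + δ) (𝓝[>] 0) (𝓝 δ) := by
    have : Continuous fun t : ℝ ↦ t * (2 * D + 1) + δ := by fun_prop
    simpa using this.continuousWithinAt (s := Ioi 0) (x := 0) |>.tendsto
  exact le_of_tendsto_of_tendsto l1 l2 key

/-! ### Local coordinates -/

/-- Two directions are perpendicular. -/
def Dir.Perp (e f : Dir) : Prop := e ≠ f ∧ e ≠ f.opp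

theorem Dir.Perp.symm {e f : Dir} (h : e.Perp f) : f.Perp e := by
  cases e <;> cases f <;> simp_all [Dir.Perp, Dir.opp]

theorem Dir.Perp.opp_left {e f : Dir} (h : e.Perp f) : e.opp.Perp f := by
  cases e <;> cases f <;> simp_all [Dir.Perp, Dir.opp]

theorem Dir.Perp.opp_right {e f : Dir} (h : e.Perp f) : e.Perp f.opp := h.symm.opp_left.symm

theorem Dir.exists_perp (e : Dir) : ∃ f : Dir, e.Perp f := by
  cases e
  exacts [⟨.up, by simp [Perp, opp]⟩, ⟨.right, by simp [Perp, opp]⟩, ⟨.up, by simp [Perp, opp]⟩,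
    ⟨.right, by simp [Perp, opp]⟩]

theorem Dir.Perp.cases {e f : Dir} (h : e.Perp f) (g : Dir) :
    g = e ∨ g = e.opp ∨ g = f ∨ g = f.opp := by
  cases e <;> cases f <;> cases g <;> simp_all [Dir.Perp, Dir.opp]

/-- The distance from `w` to the side of the rectangle in direction `e`. -/
def room (R : Rect) (w : ℝ × ℝ) : Dir → ℝ
  | .right => R.right - w.1
  | .up => R.top - w.2
  | .left => w.1 - R.left
  | .down => w.2 - R.bottom

theorem room_add_room_opp_pos (R : Rect) (w : ℝ × ℝ) (e : Dir) :
    0 < room R w e + room R w e.opp := by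
  have := R.left_lt_right
  have := R.bottom_lt_top
  cases e <;> simp [room, Dir.opp] <;> linarith

/-- The point with coordinates `z` in the frame at `w` with axes `e` and `f`. -/
def frame (w : ℝ × ℝ) (e f : Dir) (z : ℝ × ℝ) : ℝ × ℝ :=
  (w.1 + z.1 * e.vec.1 + z.2 * f.vec.1, w.2 + z.1 * e.vec.2 + z.2 * f.vec.2)

/-- The coordinates of `x` in the frame at `w` with axes `e` and `f`. -/
def coords (w : ℝ × ℝ) (e f : Dir) (x : ℝ × ℝ) : ℝ × ℝ := (offset w e x, offset w f x)

/-- The rectangle in the frame at `w` with axes `e` and `f`. -/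
def localRect (R : Rect) (w : ℝ × ℝ) (e f : Dir) : Rect where
  left := -room R w e.opp
  right := room R w e
  bottom := -room R w f.opp
  top := room R w f
  left_lt_right := by linarith [room_add_room_opp_pos R w e]
  bottom_lt_top := by linarith [room_add_room_opp_pos R w f]

section Frame

variable {e f : Dir} (w : ℝ × ℝ)

theorem coords_frame (h : e.Perp f) (z : ℝ × ℝ) : coords w e f (frame w e f z) = z := by
  cases e <;> cases f <;> simp [Dir.Perp, Dir.opp] at h <;>
    simp [coords, offset, frame, Dir.vec]

theorem frame_coords (h : e.Perp f) (x : ℝ × ℝ) : frame w e f (coords w e f x) = x := by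
  cases e <;> cases f <;> simp [Dir.Perp, Dir.opp] at h <;>
    simp [coords, offset, frame, Dir.vec]

theorem dM_frame (h : e.Perp f) (z z' : ℝ × ℝ) :
    dM (frame w e f z) (frame w e f z') = dM z z' := by
  have h1 := abs_sub_comm z.1 z'.1
  have h2 := abs_sub_comm z.2 z'.2
  cases e <;> cases f <;> simp [Dir.Perp, Dir.opp] at h <;>
    simp [dM, deltaX, deltaY, frame, Dir.vec, ← sub_eq_add_neg, add_comm, h1, h2]

theorem frame_mem_toSet (h : e.Perp f) (R : Rect) (z : ℝ × ℝ) :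
    frame w e f z ∈ R.toSet ↔ z ∈ (localRect R w e f).toSet := by
  simp only [Rect.mem_toSet, localRect]
  cases e <;> cases f <;> simp [Dir.Perp, Dir.opp] at h <;>
    simp only [frame, Dir.vec, room, Dir.opp] <;>
    constructor <;> rintro ⟨⟨h1, h2⟩, h3, h4⟩ <;> refine ⟨⟨?_, ?_⟩, ?_, ?_⟩ <;> linarith

/-- Each of the eight frames is a product of translations and reflections of the line, preceded by a
swap of coordinates when `e` is vertical. -/
theorem measurePreserving_frame (h : e.Perp f) :
    MeasurePreserving (frame w e f) (volume : Measure (ℝ × ℝ)) volume := by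
  have a1 := measurePreserving_add_left (volume : Measure ℝ) w.1
  have a2 := measurePreserving_add_left (volume : Measure ℝ) w.2
  have b1 := Measure.measurePreserving_sub_left (volume : Measure ℝ) w.1
  have b2 := Measure.measurePreserving_sub_left (volume : Measure ℝ) w.2
  have s := Measure.measurePreserving_swap (μ := (volume : Measure ℝ)) (ν := (volume : Measure ℝ))
  rw [Measure.volume_eq_prod]
  cases e <;> cases f <;> simp [Dir.Perp, Dir.opp] at h
  · convert! a1.prod a2 using 1
    ext z <;> simp [frame, Dir.vec]
  · convert! a1.prod b2 using 1
    ext z <;> simp [frame, Dir.vec, sub_eq_add_neg]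
  · convert! (a1.prod a2).comp s using 1
    ext z <;> simp [frame, Dir.vec]
  · convert! (b1.prod a2).comp s using 1
    ext z <;> simp [frame, Dir.vec, sub_eq_add_neg]
  · convert! b1.prod a2 using 1
    ext z <;> simp [frame, Dir.vec, sub_eq_add_neg]
  · convert! b1.prod b2 using 1
    ext z <;> simp [frame, Dir.vec, sub_eq_add_neg]
  · convert! (a1.prod b2).comp s using 1
    ext z <;> simp [frame, Dir.vec, sub_eq_add_neg]
  · convert! (b1.prod b2).comp s using 1
    ext z <;> simp [frame, Dir.vec, sub_eq_add_neg]

theorem area_preimage_frame (h : e.Perp f) {S : Set (ℝ × ℝ)} (hS : MeasurableSet S) :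
    area (frame w e f ⁻¹' S) = area S := by
  simp only [area, Measure.real]
  rw [(measurePreserving_frame w h).measure_preimage hS.nullMeasurableSet]

theorem frame_zero : frame w e f 0 = w := by simp [frame]

theorem frame_mk_zero (t : ℝ) : frame w e f (t, 0) = w + t • e.vec := by
  ext <;> simp [frame]

theorem frame_zero_mk (t : ℝ) : frame w e f (0, t) = w + t • f.vec := by
  ext <;> simp [frame]

theorem frame_neg_zero (t : ℝ) : frame w e f (-t, 0) = w + t • e.opp.vec := by
  cases e <;> ext <;> simp [frame, Dir.vec, Dir.opp]

theorem frame_zero_neg (t : ℝ) : frame w e f (0, -t) = w + t • f.opp.vec := by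
  cases f <;> ext <;> simp [frame, Dir.vec, Dir.opp]

/-- The set `W` in the frame at `w` with axes `e` and `f`. -/
def localSet (W : Finset (ℝ × ℝ)) (w : ℝ × ℝ) (e f : Dir) : Finset (ℝ × ℝ) :=
  W.image (coords w e f)

theorem mem_localSet (h : e.Perp f) {W : Finset (ℝ × ℝ)} {z : ℝ × ℝ} :
    z ∈ localSet W w e f ↔ frame w e f z ∈ W := by
  constructor
  · intro hz
    obtain ⟨x, hx, rfl⟩ := Finset.mem_image.1 hz
    rwa [frame_coords w h]
  · intro hz
    exact Finset.mem_image.2 ⟨_, hz, coords_frame w h z⟩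

theorem forall_mem_localSet (h : e.Perp f) {W : Finset (ℝ × ℝ)} {P : ℝ × ℝ → Prop} :
    (∀ z ∈ localSet W w e f, P (frame w e f z)) ↔ ∀ q ∈ W, P q := by
  constructor
  · intro hP q hq
    have := hP (coords w e f q) (Finset.mem_image_of_mem _ hq)
    rwa [frame_coords w h] at this
  · exact fun hP z hz ↦ hP _ ((mem_localSet w h).1 hz)

theorem frame_mem_closedCell (h : e.Perp f) (R : Rect) (W : Finset (ℝ × ℝ)) (z : ℝ × ℝ) :
    frame w e f z ∈ closedCell R W w ↔
      z ∈ closedCell (localRect R w e f) (localSet W w e f) 0 := by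
  refine and_congr (frame_mem_toSet w h R z) ?_
  rw [← forall_mem_localSet w h (P := fun q ↦ dM (frame w e f z) w ≤ dM (frame w e f z) q)]
  refine forall₂_congr fun q _ ↦ ?_
  nth_rw 2 [← frame_zero (e := e) (f := f) w]
  rw [dM_frame w h, dM_frame w h]

theorem frame_mem_openCell (h : e.Perp f) (R : Rect) (W : Finset (ℝ × ℝ)) (z : ℝ × ℝ) :
    frame w e f z ∈ openCell R W w ↔
      z ∈ openCell (localRect R w e f) (localSet W w e f) 0 := by
  refine and_congr (frame_mem_toSet w h R z) ?_
  rw [← forall_mem_localSet w h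
    (P := fun q ↦ q ≠ w → dM (frame w e f z) w < dM (frame w e f z) q)]
  refine forall₂_congr fun q _ ↦ imp_congr (not_congr ⟨fun hq ↦ ?_, fun hq ↦ ?_⟩) ?_
  · rw [← coords_frame w h q, hq]
    simp [coords, offset]
  · rw [hq, frame_zero]
  · nth_rw 2 [← frame_zero (e := e) (f := f) w]
    rw [dM_frame w h, dM_frame w h]

theorem frame_mem_captured (h : e.Perp f) (R : Rect) (W : Finset (ℝ × ℝ)) (b z : ℝ × ℝ) :
    frame w e f z ∈ captured R W {frame w e f b} ↔
      z ∈ captured (localRect R w e f) (localSet W w e f) {b} := by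
  rw [mem_captured_singleton, mem_captured_singleton]
  refine and_congr (frame_mem_toSet w h R z) ?_
  rw [← forall_mem_localSet w h
    (P := fun q ↦ dM (frame w e f z) (frame w e f b) < dM (frame w e f z) q)]
  refine forall₂_congr fun q _ ↦ ?_
  rw [dM_frame w h, dM_frame w h]

end Frame

/-! ### Arms of open cells -/

theorem add_smul_mem_toSet {R : Rect} {w : ℝ × ℝ} (hw : w ∈ R.toSet) {e : Dir} {t : ℝ}
    (ht : 0 ≤ t) : w + t • e.vec ∈ R.toSet ↔ t ≤ room R w e := by
  rw [Rect.mem_toSet] at *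
  obtain ⟨⟨h1, h2⟩, h3, h4⟩ := hw
  cases e <;> simp only [Dir.vec, room, Prod.fst_add, Prod.snd_add, Prod.smul_mk, smul_eq_mul] <;>
    constructor <;> intro h <;> first | linarith | (refine ⟨⟨?_, ?_⟩, ?_, ?_⟩ <;> linarith)

theorem dM_add_smul_self (w : ℝ × ℝ) (e : Dir) {t : ℝ} (ht : 0 ≤ t) :
    dM (w + t • e.vec) w = t := by
  cases e <;> simp [dM, deltaX, deltaY, Dir.vec, abs_of_nonneg ht]

theorem dM_add_smul_add_smul (w : ℝ × ℝ) (e : Dir) {s t : ℝ} (h : s ≤ t) :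
    dM (w + t • e.vec) (w + s • e.vec) = t - s := by
  have h1 : |t - s| = t - s := abs_of_nonneg (by linarith)
  have h2 : |s - t| = t - s := by rw [abs_sub_comm, h1]
  cases e <;> simp [dM, deltaX, deltaY, Dir.vec, h1, neg_add_eq_sub, h2]

/-- The length of the arm in direction `e` of the open cell of `w`. -/
def arm (R : Rect) (W : Finset (ℝ × ℝ)) (w : ℝ × ℝ) (e : Dir) : ℝ :=
  sSup {t : ℝ | 0 ≤ t ∧ w + t • e.vec ∈ openCell R W w}

section Arm

variable {R : Rect} {W : Finset (ℝ × ℝ)} {w : ℝ × ℝ} {e f : Dir}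

theorem self_mem_openCell (hw : w ∈ R.toSet) : w ∈ openCell R W w :=
  ⟨hw, fun q _ hq ↦ by rw [dM_self]; exact dM_pos hq.symm⟩

theorem add_smul_mem_openCell_of_le (hw : w ∈ R.toSet) {s t : ℝ} (hs : 0 ≤ s) (hst : s ≤ t)
    (h : w + t • e.vec ∈ openCell R W w) : w + s • e.vec ∈ openCell R W w := by
  refine mem_openCell_of_between h ?_ ?_
  · rw [add_smul_mem_toSet hw hs]
    exact hst.trans ((add_smul_mem_toSet hw (hs.trans hst)).1 h.1)
  · rw [dM_add_smul_add_smul w e hst, dM_add_smul_self w e hs,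
      dM_add_smul_self w e (hs.trans hst)]
    ring

theorem bddAbove_arm (hw : w ∈ R.toSet) :
    BddAbove {t : ℝ | 0 ≤ t ∧ w + t • e.vec ∈ openCell R W w} :=
  ⟨room R w e, fun _ ht ↦ (add_smul_mem_toSet hw ht.1).1 ht.2.1⟩

theorem le_arm (hw : w ∈ R.toSet) {t : ℝ} (ht : 0 ≤ t)
    (h : w + t • e.vec ∈ openCell R W w) : t ≤ arm R W w e :=
  le_csSup (bddAbove_arm hw) ⟨ht, h⟩

theorem arm_nonneg (hw : w ∈ R.toSet) : 0 ≤ arm R W w e :=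
  le_arm hw le_rfl (by simpa using self_mem_openCell hw)

theorem arm_le (hw : w ∈ R.toSet) {c : ℝ}
    (h : ∀ t : ℝ, 0 ≤ t → w + t • e.vec ∈ openCell R W w → t ≤ c) : arm R W w e ≤ c :=
  csSup_le ⟨0, le_rfl, by simpa using self_mem_openCell hw⟩ fun t ht ↦ h t ht.1 ht.2

theorem arm_le_room (hw : w ∈ R.toSet) : arm R W w e ≤ room R w e :=
  arm_le hw fun _ ht h ↦ (add_smul_mem_toSet hw ht).1 h.1

/-- A point of `W` at equal distance blocks the arm. -/
theorem arm_le_of_dM_le (hw : w ∈ R.toSet) {q : ℝ × ℝ} (hq : q ∈ W) (hqw : q ≠ w) {t : ℝ}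
    (ht : 0 ≤ t) (h : dM (w + t • e.vec) q ≤ t) : arm R W w e ≤ t := by
  refine arm_le hw fun s hs hmem ↦ ?_
  by_contra! hlt
  have h1 := (add_smul_mem_openCell_of_le hw ht hlt.le hmem).2 q hq hqw
  rw [dM_add_smul_self w e ht] at h1
  linarith

end Arm

/-! ### Arms of an unbeatable set -/

theorem offset_add_room (R : Rect) (w q : ℝ × ℝ) (e : Dir) :
    offset w e q + room R q e = room R w e := by
  cases e <;> simp [offset, room, Dir.vec]

theorem room_nonneg {R : Rect} {w : ℝ × ℝ} (hw : w ∈ R.toSet) (e : Dir) : 0 ≤ room R w e := by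
  rw [Rect.mem_toSet] at hw
  cases e <;> simp only [room] <;> linarith

section Unbeatable

variable {R : Rect} {W : Finset (ℝ × ℝ)} {w : ℝ × ℝ} {e f : Dir}

/-- The points of an unbeatable set are interior points of the rectangle. -/
theorem Unbeatable.room_pos (hunb : Unbeatable R W) (hW : (W : Set (ℝ × ℝ)) ⊆ R.toSet)
    (hw : w ∈ W) (e : Dir) : 0 < room R w e := by
  have h1 := hunb.area_half_closedCell hW hw e
  have hn : (0 : ℝ) < W.card := by exact_mod_cast Finset.card_pos.2 ⟨w, hw⟩
  have h2 : 0 < 1 / (2 * (W.card : ℝ)) * area R.toSet := mul_pos (by positivity) R.area_pos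
  rw [← h1] at h2
  have h3 : (closedCell R W w ∩ openHalf w e).Nonempty := by
    by_contra hne
    rw [not_nonempty_iff_eq_empty] at hne
    simp [hne, area] at h2
  obtain ⟨x, hx, hx' : 0 < offset w e x⟩ := h3
  have := offset_add_room R w x e
  have := room_nonneg hx.1 e
  linarith

theorem offset_frame_left (h : e.Perp f) (z : ℝ × ℝ) : offset w e (frame w e f z) = z.1 :=
  congrArg Prod.fst (coords_frame w h z)

theorem offset_frame_right (h : e.Perp f) (z : ℝ × ℝ) : offset w f (frame w e f z) = z.2 :=
  congrArg Prod.snd (coords_frame w h z)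

theorem Unbeatable.area_captured_local_le (hunb : Unbeatable R W)
    (hW : (W : Set (ℝ × ℝ)) ⊆ R.toSet) (hw : w ∈ W) (h : e.Perp f) :
    ∀ b ∈ (localRect R w e f).toSet, b ∉ localSet W w e f →
      area (captured (localRect R w e f) (localSet W w e f) {b}) ≤
        1 / (2 * (W.card : ℝ)) * area R.toSet := by
  intro b hb hbW
  rw [← frame_mem_toSet w h] at hb
  rw [mem_localSet w h] at hbW
  have h1 := hunb.area_captured_singleton_le hW ⟨w, hw⟩ hb hbW
  rw [← area_preimage_frame w h (measurableSet_captured _ _ _)] at h1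
  convert h1 using 2
  ext z
  exact (frame_mem_captured w h R W b z).symm

theorem Unbeatable.area_local_left (hunb : Unbeatable R W)
    (hW : (W : Set (ℝ × ℝ)) ⊆ R.toSet) (hw : w ∈ W) (h : e.Perp f) :
    area (openCell (localRect R w e f) (localSet W w e f) 0 ∩ {x | 0 < x.1}) =
        1 / (2 * (W.card : ℝ)) * area R.toSet := by
  rw [← hunb.area_half_openCell hW hw e, ← area_preimage_frame w h
    ((measurableSet_openCell R W w).inter (measurableSet_openHalf w e))]
  congr 1
  ext z
  refine and_congr (frame_mem_openCell w h R W z).symm ?_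
  change 0 < z.1 ↔ 0 < offset w e _
  rw [offset_frame_left h]

theorem Unbeatable.area_local_right (hunb : Unbeatable R W)
    (hW : (W : Set (ℝ × ℝ)) ⊆ R.toSet) (hw : w ∈ W) (h : e.Perp f) :
    area (openCell (localRect R w e f) (localSet W w e f) 0 ∩ {x | 0 < x.2}) =
        1 / (2 * (W.card : ℝ)) * area R.toSet := by
  rw [← hunb.area_half_openCell hW hw f, ← area_preimage_frame w h
    ((measurableSet_openCell R W w).inter (measurableSet_openHalf w f))]
  congr 1
  ext z
  refine and_congr (frame_mem_openCell w h R W z).symm ?_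
  change 0 < z.2 ↔ 0 < offset w f _
  rw [offset_frame_right h]

/-- The closed cell is essential for `Unbeatable.armLength_eq`, where the point on the ray may be
tied with another white point. -/
theorem Unbeatable.le_arm_opp_of_mem_closedCell (hunb : Unbeatable R W)
    (hW : (W : Set (ℝ × ℝ)) ⊆ R.toSet) (hw : w ∈ W) (h : e.Perp f)
    (hf : arm R W w f < room R w f) {α : ℝ} (hα : w + α • e.vec ∈ closedCell R W w) :
    α ≤ arm R W w f.opp := by
  have hwR := hW hw
  refine right_le_down (R := localRect R w e f) (W := localSet W w e f)
    (neg_nonpos.2 (room_nonneg hwR _)) (hunb.room_pos hW hw e)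
    (neg_nonpos.2 (room_nonneg hwR _)) (hunb.room_pos hW hw f)
    (hunb.area_captured_local_le hW hw h) (hunb.area_local_left hW hw h) hf ?_
    (arm_nonneg hwR) ?_ ?_
  · intro y hy hyU
    rw [← frame_mem_openCell w h, frame_zero_mk] at hyU
    exact le_arm hwR hy hyU
  · intro y hy hyU
    rw [← frame_mem_openCell w h, frame_zero_neg] at hyU
    exact le_arm hwR hy hyU
  · rwa [← frame_mem_closedCell w h, frame_mk_zero]

theorem Unbeatable.arm_le_arm_opp (hunb : Unbeatable R W)
    (hW : (W : Set (ℝ × ℝ)) ⊆ R.toSet) (hw : w ∈ W) (h : e.Perp f)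
    (hf : arm R W w f < room R w f) : arm R W w e ≤ arm R W w e.opp := by
  have hwR := hW hw
  refine arm_le hwR fun α _ hα ↦ ?_
  refine right_le_left (R := localRect R w e f) (W := localSet W w e f)
    (neg_nonpos.2 (room_nonneg hwR _)) (hunb.room_pos hW hw e)
    (neg_nonpos.2 (room_nonneg hwR _)) (hunb.room_pos hW hw f)
    (hunb.area_captured_local_le hW hw h) (hunb.area_local_right hW hw h) hf ?_
    (arm_nonneg hwR) ?_ ?_
  · intro y hy hyU
    rw [← frame_mem_openCell w h, frame_zero_mk] at hyU
    exact le_arm hwR hy hyU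
  · intro y hy hyU
    rw [← frame_mem_openCell w h, frame_neg_zero] at hyU
    exact le_arm hwR hy hyU
  · rwa [← frame_mem_openCell w h, frame_mk_zero]

theorem Unbeatable.arm_le_arm_opp_of_perp (hunb : Unbeatable R W)
    (hW : (W : Set (ℝ × ℝ)) ⊆ R.toSet) (hw : w ∈ W) (h : e.Perp f)
    (hf : arm R W w f < room R w f) : arm R W w e ≤ arm R W w f.opp :=
  arm_le (hW hw) fun _ _ hα ↦ hunb.le_arm_opp_of_mem_closedCell hW hw h hf
    (openCell_subset_closedCell R W w hα)

/-- If a point on the ray in direction `e` is assigned to `w` because of a degenerate bisector,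
then the other point lies on a diagonal of the frame. -/
theorem exists_eq_frame_of_tie {q : ℝ × ℝ} (hq : q ≠ w) {s : ℝ} (hs : 0 < s)
    (h1 : deltaX w q = deltaY w q) (h2 : dM (w + s • e.vec) w = dM (w + s • e.vec) q)
    (h3 : deltaY (w + s • e.vec) q = deltaY (w + s • e.vec) w + deltaY w q) :
    ∃ f : Dir, e.Perp f ∧ ∃ A : ℝ, 0 < A ∧ A ≤ s ∧ q = frame w e f (A, A) := by
  rw [dM_add_smul_self w e hs.le] at h2
  obtain ⟨a, ha⟩ : ∃ a, q.1 = w.1 + a := ⟨q.1 - w.1, by ring⟩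
  obtain ⟨b, hb⟩ : ∃ b, q.2 = w.2 + b := ⟨q.2 - w.2, by ring⟩
  have hab : ¬(a = 0 ∧ b = 0) := fun h ↦ hq (Prod.ext (by simp [ha, h.1]) (by simp [hb, h.2]))
  have key : ∀ c d : ℝ, ¬(c = 0 ∧ d = 0) → |c| = |d| → s = |s - c| + |d| → 0 < c ∧ c ≤ s := by
    intro c d hcd hc hsc
    have hd : ¬(c = 0) := fun h ↦ hcd ⟨h, by simpa [h] using hc.symm⟩
    rcases abs_cases (s - c) with h | h <;> rcases abs_cases c with h' | h' <;>
      rcases lt_or_gt_of_ne hd with h'' | h'' <;> constructor <;> linarith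
  cases e
  · simp [deltaX, deltaY, dM, Dir.vec, ha, hb] at h1 h2
    obtain ⟨k1, k2⟩ := key a b hab h1 h2
    rw [abs_of_pos k1] at h1
    rcases abs_cases b with h | h
    · exact ⟨.up, by simp [Dir.Perp, Dir.opp], a, k1, k2, Prod.ext (by simp [frame, Dir.vec, ha])
        (by simp [frame, Dir.vec, hb]; linarith)⟩
    · exact ⟨.down, by simp [Dir.Perp, Dir.opp], a, k1, k2,
        Prod.ext (by simp [frame, Dir.vec, ha]) (by simp [frame, Dir.vec, hb]; linarith)⟩
  -- On a vertical ray the condition `h3` leaves no room for a tie: a degenerate bisector gives its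
  -- neutral regions to the vertically nearer point.
  · exfalso
    simp [deltaX, deltaY, dM, Dir.vec, ha, hb, abs_of_pos hs] at h1 h2 h3
    have h4 : |a| = 0 := by have := abs_nonneg a; have := abs_nonneg b; linarith
    exact hab ⟨abs_eq_zero.1 h4, abs_eq_zero.1 (h1 ▸ h4)⟩
  · simp [deltaX, deltaY, dM, Dir.vec, ha, hb] at h1 h2
    have h5 : |-s - a| = |s - -a| := by rw [← abs_neg]; congr 1; ring
    obtain ⟨k1, k2⟩ := key (-a) b (by simpa using hab) (by simpa using h1) (by rwa [h5] at h2)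
    rw [abs_of_neg (by linarith)] at h1
    rcases abs_cases b with h | h
    · exact ⟨.up, by simp [Dir.Perp, Dir.opp], -a, k1, k2, Prod.ext (by simp [frame, Dir.vec, ha])
        (by simp [frame, Dir.vec, hb]; linarith)⟩
    · exact ⟨.down, by simp [Dir.Perp, Dir.opp], -a, k1, k2,
        Prod.ext (by simp [frame, Dir.vec, ha]) (by simp [frame, Dir.vec, hb]; linarith)⟩
  · exfalso
    simp [deltaX, deltaY, dM, Dir.vec, ha, hb, abs_of_pos hs] at h1 h2 h3
    have h4 : |a| = 0 := by have := abs_nonneg a; have := abs_nonneg b; linarith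
    exact hab ⟨abs_eq_zero.1 h4, abs_eq_zero.1 (h1 ▸ h4)⟩

/-- An arm prolonged by a tie requires a white point at `(A, A)` in a suitable frame. It blocks the
open arms in directions `e` and `f` at `A`, before the boundary, because white points are interior.
The arm inequalities then bound the prolonged arm by the arm in direction `f.opp`, and this one by
the arm in direction `f`, hence by `A`, a contradiction. -/
theorem Unbeatable.armLength_eq (hunb : Unbeatable R W)
    (hW : (W : Set (ℝ × ℝ)) ⊆ R.toSet) (hw : w ∈ W) (e : Dir) :
    armLength R W w e = arm R W w e := by
  have hwR := hW hw
  have hne : {t : ℝ | 0 ≤ t ∧ ∀ s ∈ Set.Icc 0 t, w + s • e.vec ∈ cell R W w}.Nonempty := by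
    refine ⟨0, le_rfl, fun s hs ↦ ?_⟩
    obtain rfl : s = 0 := le_antisymm hs.2 hs.1
    simpa using openCell_subset_cell R W w (self_mem_openCell hwR)
  refine le_antisymm ?_ ?_
  · by_contra! hlt
    obtain ⟨s, ⟨hs0, hs⟩, hlts⟩ := exists_lt_of_lt_csSup hne hlt
    obtain ⟨r, hr, hrs⟩ := exists_between hlts
    have h0 : 0 ≤ arm R W w e := arm_nonneg hwR
    have hr0 : 0 < r := by linarith
    have hrc := hs r ⟨hr0.le, hrs.le⟩
    have hro : w + r • e.vec ∉ openCell R W w := fun h ↦ hr.not_ge (le_arm hwR hr0.le h)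
    obtain ⟨q, hq, hqw, hnlt⟩ : ∃ q ∈ W, q ≠ w ∧
        ¬ dM (w + r • e.vec) w < dM (w + r • e.vec) q := by
      by_contra! hc
      exact hro ⟨hrc.1, hc⟩
    obtain ⟨t1, t2, t3⟩ := (hrc.2 q hq hqw).resolve_left hnlt
    obtain ⟨f, hef, A, hA0, hAr, rfl⟩ := exists_eq_frame_of_tie hqw hr0 t1 t2 t3
    have a1 : arm R W w e ≤ A := by
      refine arm_le_of_dM_le hwR hq hqw hA0.le ?_
      rw [← frame_mk_zero (f := f), dM_frame w hef]
      simp [dM, deltaX, deltaY, abs_of_pos hA0]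
    have a2 : arm R W w f ≤ A := by
      refine arm_le_of_dM_le hwR hq hqw hA0.le ?_
      rw [← frame_zero_mk (e := e), dM_frame w hef]
      simp [dM, deltaX, deltaY, abs_of_pos hA0]
    have b1 := offset_add_room R w (frame w e f (A, A)) e
    have b2 := offset_add_room R w (frame w e f (A, A)) f
    rw [offset_frame_left hef] at b1
    rw [offset_frame_right hef] at b2
    have c1 := hunb.room_pos hW hq e
    have c2 := hunb.room_pos hW hq f
    have d1 := hunb.le_arm_opp_of_mem_closedCell hW hw hef (by linarith)
      (cell_subset_closedCell R W w (hs s ⟨hs0, le_rfl⟩))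
    have d2 := hunb.arm_le_arm_opp hW hw hef.symm.opp_left (by linarith)
    rw [Dir.opp_opp] at d2
    linarith
  · refine arm_le hwR fun t ht hmem ↦ le_csSup ⟨room R w e, fun s hs ↦ ?_⟩ ⟨ht, fun s hs ↦ ?_⟩
    · exact (add_smul_mem_toSet hwR hs.1).1 (hs.2 s ⟨hs.1, le_rfl⟩).1
    · exact openCell_subset_cell R W w (add_smul_mem_openCell_of_le hwR hs.1 hs.2 hmem)

/-- As `w` is an interior point, an end point on the frontier can only lie on the side towards which
the arm points. -/
theorem Unbeatable.isBoundaryArm_iff (hunb : Unbeatable R W)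
    (hW : (W : Set (ℝ × ℝ)) ⊆ R.toSet) (hw : w ∈ W) (e : Dir) :
    IsBoundaryArm R W w e ↔ arm R W w e = room R w e := by
  have hwR := hW hw
  have h0 : 0 ≤ arm R W w e := arm_nonneg hwR
  have h1 : arm R W w e ≤ room R w e := arm_le_room hwR
  have hcl : IsClosed R.toSet := isClosed_Icc.prod isClosed_Icc
  have hmem := (add_smul_mem_toSet hwR h0).2 h1
  have r1 := hunb.room_pos hW hw .right
  have r2 := hunb.room_pos hW hw .up
  have r3 := hunb.room_pos hW hw .left
  have r4 := hunb.room_pos hW hw .down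
  rw [IsBoundaryArm, hunb.armLength_eq hW hw, hcl.frontier_eq, Set.mem_sdiff, and_iff_right hmem,
    Rect.toSet, interior_prod_eq, interior_Icc, interior_Icc, Set.mem_prod, mem_Ioo, mem_Ioo]
  have h2 : arm R W w e = room R w e ↔ ¬ arm R W w e < room R w e :=
    ⟨fun h ↦ h.not_lt, fun h ↦ le_antisymm h1 (not_lt.1 h)⟩
  rw [h2]
  refine not_congr ?_
  generalize arm R W w e = t at *
  cases e <;> simp only [Dir.vec, room, Prod.fst_add, Prod.snd_add, Prod.smul_mk, smul_eq_mul]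
    at * <;> refine ⟨fun h ↦ by linarith [h.1.1, h.1.2, h.2.1, h.2.2],
      fun h ↦ ⟨⟨by linarith, by linarith⟩, by linarith, by linarith⟩⟩

/-- Every other point of the set blocks some arm before the boundary, and takes nothing from the
half plane behind `w`. -/
theorem Unbeatable.exists_arm_lt_room (hunb : Unbeatable R W)
    (hW : (W : Set (ℝ × ℝ)) ⊆ R.toSet) (hw : w ∈ W) {q : ℝ × ℝ} (hq : q ∈ W) (hqw : q ≠ w) :
    ∃ g : Dir, arm R W w g < room R w g ∧ ∀ x, offset w g x ≤ 0 → dM x w ≤ dM x q := by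
  obtain ⟨g, hg0, hg1, hg2⟩ := exists_dominant_dir hqw
  have h1 := arm_le_of_dM_le (hW hw) hq hqw hg0.le hg1
  have h2 := offset_add_room R w q g
  have h3 := hunb.room_pos hW hq g
  exact ⟨g, by linarith, hg2⟩

/-- If all arms but the one in direction `f` reach the boundary, then the opposite arm is not
longer than the one in direction `f`. -/
theorem Unbeatable.room_opp_le_arm (hunb : Unbeatable R W)
    (hW : (W : Set (ℝ × ℝ)) ⊆ R.toSet) (hw : w ∈ W)
    (hf : ∀ g, g ≠ f → arm R W w g = room R w g) : room R w f.opp ≤ arm R W w f := by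
  have hwR := hW hw
  obtain ⟨e, hfe⟩ := f.exists_perp
  have hef := hfe.symm
  have h1 := hunb.area_half_closedCell hW hw f.opp
  rw [← hunb.area_half_openCell hW hw f,
    ← area_preimage_frame w hef ((measurableSet_openCell R W w).inter (measurableSet_openHalf w f)),
    ← area_preimage_frame w hef
      ((measurableSet_closedCell R W w).inter (measurableSet_openHalf w f.opp))] at h1
  have hsub : ∀ {S T : Set (ℝ × ℝ)}, S ⊆ R.toSet →
      frame w e f ⁻¹' (S ∩ T) ⊆ (localRect R w e f).toSet := fun hS z hz ↦
    (frame_mem_toSet w hef R z).1 (hS hz.1)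
  have h2 : area (Icc (-room R w e.opp) (room R w e) ×ˢ Ico (-room R w f.opp) 0) ≤
      area (frame w e f ⁻¹' (closedCell R W w ∩ openHalf w f.opp)) := by
    refine Rect.area_mono _ (hsub (closedCell_subset R W w)) ?_
    rintro z ⟨⟨hz1, hz2⟩, hz3, hz4⟩
    have hzf : offset w f (frame w e f z) = z.2 := offset_frame_right hef z
    refine ⟨⟨(frame_mem_toSet w hef R z).2 (Rect.mem_toSet.2 ⟨⟨hz1, hz2⟩, hz3, ?_⟩),
      fun q hq ↦ ?_⟩, ?_⟩
    · exact hz4.le.trans (room_nonneg hwR f)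
    · rcases eq_or_ne q w with rfl | hqw
      · exact le_rfl
      obtain ⟨g, hg1, hg2⟩ := hunb.exists_arm_lt_room hW hw hq hqw
      -- Every other white point blocks an arm, and only the arm in direction `f` can be blocked. So
      -- the whole rectangle behind `w` belongs to the closed cell.
      obtain rfl : g = f := by
        by_contra hgf
        exact hg1.ne (hf g hgf)
      exact hg2 _ (by rw [hzf]; exact hz4.le)
    · change 0 < offset w f.opp _
      rw [offset_opp, hzf]
      linarith
  -- The front half lies in a rectangle of the same width and of height `arm R W w f`; equality of
  -- the two half cell areas compares the heights.
  have h3 : area (frame w e f ⁻¹' (openCell R W w ∩ openHalf w f)) ≤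
      area (Icc (-room R w e.opp) (room R w e) ×ˢ Icc 0 (arm R W w f)) := by
    refine measureReal_mono ?_ (isCompact_Icc.prod isCompact_Icc).measure_lt_top.ne
    rintro z ⟨hz, hz'⟩
    have hz2 : 0 < z.2 := by
      have : 0 < offset w f (frame w e f z) := hz'
      rwa [offset_frame_right hef] at this
    have hzR := Rect.mem_toSet.1 ((frame_mem_toSet w hef R z).1 hz.1)
    refine ⟨hzR.1, hz2.le, le_arm hwR hz2.le ?_⟩
    rw [← frame_zero_mk (e := e)]
    rw [frame_mem_openCell w hef] at hz ⊢
    refine mem_openCell_of_between hz (Rect.mem_toSet.2 ⟨?_, hzR.2⟩) ?_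
    · exact ⟨neg_nonpos.2 (room_nonneg hwR _), room_nonneg hwR _⟩
    · rw [dM_mk, dM_zero, dM_zero]; simp
  have hpos := room_add_room_opp_pos R w e
  rw [area_prod_Icc (by linarith) (arm_nonneg hwR)] at h3
  rw [area, Measure.volume_eq_prod, measureReal_prod_prod, Real.volume_real_Icc_of_le
    (by linarith), Real.volume_real_Ico_of_le (by simpa using room_nonneg hwR _)] at h2
  have h4 : (room R w e - -room R w e.opp) * room R w f.opp ≤
      (room R w e - -room R w e.opp) * arm R W w f := by
    linarith
  exact le_of_mul_le_mul_left h4 (by linarith)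

/-- Each short arm equalizes the two arms perpendicular to it, and the mixed inequalities in both
directions link the two axes. -/
theorem Unbeatable.arm_eq_of_not_bridge (hunb : Unbeatable R W)
    (hW : (W : Set (ℝ × ℝ)) ⊆ R.toSet) (hw : w ∈ W) (h : e.Perp f)
    (he : arm R W w e < room R w e) (hf : arm R W w f < room R w f) (g : Dir) :
    arm R W w g = arm R W w e.opp := by
  have e1 := hunb.arm_le_arm_opp hW hw h hf
  have e2 := hunb.arm_le_arm_opp hW hw h.opp_left hf
  have e3 := hunb.arm_le_arm_opp_of_perp hW hw h.opp_left hf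
  have f1 := hunb.arm_le_arm_opp hW hw h.symm he
  have f2 := hunb.arm_le_arm_opp hW hw h.symm.opp_left he
  have f3 := hunb.arm_le_arm_opp_of_perp hW hw h.symm.opp_left he
  rw [Dir.opp_opp] at e2 f2
  rcases h.cases g with rfl | rfl | rfl | rfl <;> linarith

theorem Unbeatable.bridge_aux (hunb : Unbeatable R W)
    (hW : (W : Set (ℝ × ℝ)) ⊆ R.toSet) (hw : w ∈ W) (h : e.Perp f)
    (he : arm R W w e = room R w e) (he' : arm R W w e.opp = room R w e.opp)
    (hf : arm R W w f < room R w f) :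
    arm R W w e = arm R W w e.opp ∧ ∀ g, arm R W w e ≤ arm R W w g := by
  have e1 := hunb.arm_le_arm_opp hW hw h hf
  have e2 := hunb.arm_le_arm_opp hW hw h.opp_left hf
  have e3 := hunb.arm_le_arm_opp_of_perp hW hw h hf
  rw [Dir.opp_opp] at e2
  have e4 : arm R W w e ≤ arm R W w f := by
    rcases (arm_le_room (W := W) (e := f.opp) (hW hw)).lt_or_eq with hlt | heq
    · simpa using hunb.arm_le_arm_opp_of_perp hW hw h.opp_right hlt
    -- With three boundary arms the perturbation argument has no short arm opposite `f` to use; the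
    -- area comparison gives `arm R W w f.opp ≤ arm R W w f`, and `e3` completes the chain.
    · have := hunb.room_opp_le_arm hW hw (f := f) fun g hg ↦ by
        rcases h.cases g with rfl | rfl | rfl | rfl
        exacts [he, he', (hg rfl).elim, heq]
      linarith
  refine ⟨le_antisymm e1 e2, fun g ↦ ?_⟩
  rcases h.cases g with rfl | rfl | rfl | rfl
  exacts [le_rfl, e1, e4, e3]

end Unbeatable

end ManhattanVoronoi

end

/-! ### Assembly of P1 and P2 -/

theorem theorem4p1 (R : ManhattanVoronoi.Rect) (W : Finset (ℝ × ℝ))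
    (hW : (W : Set (ℝ × ℝ)) ⊆ R.toSet) (hunb : ManhattanVoronoi.Unbeatable R W) :
    -- (P1)
    (∀ w ∈ W, ∀ e : ManhattanVoronoi.Dir,
      ManhattanVoronoi.area (ManhattanVoronoi.halfCell R W w e) =
        1 / (2 * (W.card : ℝ)) * ManhattanVoronoi.area R.toSet) ∧
    -- (P2), cells that are not bridges
    (∀ w ∈ W, ¬ ManhattanVoronoi.IsBridge R W w → ∀ e e' : ManhattanVoronoi.Dir,
      ManhattanVoronoi.armLength R W w e = ManhattanVoronoi.armLength R W w e') ∧
    -- (P2), bridges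
    (∀ w ∈ W, ManhattanVoronoi.IsBridge R W w → ∀ e : ManhattanVoronoi.Dir,
      ManhattanVoronoi.IsBoundaryArm R W w e → ManhattanVoronoi.IsBoundaryArm R W w e.opp →
        ManhattanVoronoi.armLength R W w e = ManhattanVoronoi.armLength R W w e.opp ∧
        (1 < W.card → ∀ e' : ManhattanVoronoi.Dir,
          ManhattanVoronoi.armLength R W w e ≤ ManhattanVoronoi.armLength R W w e')) := by
  open ManhattanVoronoi in
  refine ⟨fun w hw e ↦ hunb.area_halfCell hW hw e, fun w hw hnb e e' ↦ ?_,
    fun w hw _ e he he' ↦ ?_⟩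
  -- A cell that is not a bridge has a short arm on each axis, hence two perpendicular short arms.
  · have hd : ∀ e : Dir, ∃ g : Dir, (g = e ∨ g = e.opp) ∧ arm R W w g < room R w g := by
      intro e
      by_contra! hc
      refine hnb ⟨e, ?_, ?_⟩ <;> rw [hunb.isBoundaryArm_iff hW hw]
      · exact le_antisymm (arm_le_room (hW hw)) (hc e (Or.inl rfl))
      · exact le_antisymm (arm_le_room (hW hw)) (hc _ (Or.inr rfl))
    obtain ⟨g, hg, hg'⟩ := hd .right
    obtain ⟨h, hh, hh'⟩ := hd .up
    have hgh : g.Perp h := by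
      rcases hg with rfl | rfl <;> rcases hh with rfl | rfl <;> simp [Dir.Perp, Dir.opp]
    rw [hunb.armLength_eq hW hw, hunb.armLength_eq hW hw,
      hunb.arm_eq_of_not_bridge hW hw hgh hg' hh' e,
      hunb.arm_eq_of_not_bridge hW hw hgh hg' hh' e']
  · rw [hunb.isBoundaryArm_iff hW hw] at he he'
    simp only [hunb.armLength_eq hW hw]
    obtain ⟨f, hef⟩ := e.exists_perp
    rcases (arm_le_room (W := W) (e := f) (hW hw)).lt_or_eq with hlt | heq
    · exact (hunb.bridge_aux hW hw hef he he' hlt).imp_right fun h _ ↦ h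
    rcases (arm_le_room (W := W) (e := f.opp) (hW hw)).lt_or_eq with hlt | heq'
    · exact (hunb.bridge_aux hW hw hef.opp_right he he' hlt).imp_right fun h _ ↦ h
    -- If all four arms reach the boundary, the area comparison applies in both directions along
    -- `e`. A second white point would block one of the arms, so `1 < W.card` is contradictory here.
    have hall : ∀ g, arm R W w g = room R w g := by
      intro g
      rcases hef.cases g with rfl | rfl | rfl | rfl <;> assumption
    have h1 := hunb.room_opp_le_arm hW hw (f := e) fun g _ ↦ hall g
    have h2 := hunb.room_opp_le_arm hW hw (f := e.opp) fun g _ ↦ hall g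
    rw [Dir.opp_opp] at h2
    refine ⟨by linarith, fun hcard ↦ ?_⟩
    obtain ⟨q, hq, hqw⟩ := Finset.exists_mem_ne hcard w
    obtain ⟨g, hg, -⟩ := hunb.exists_arm_lt_room hW hw hq hqw
    exact absurd (hall g) hg.ne
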